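/- Let $n\ge 0$, let $M$ be a smooth $n$-manifold (Hausdorff, $\sigma$-compact, possibly disconnected, possibly with boundary or corners), let $\iota:M\to\mathbb R^{n+1}$ be a smooth immersion, and let $N:M\to\mathbb R^{n+1}$ be a smooth unit normal field along $\iota$; write $\Sigma$ for this two-sided immersed hypersurface and $x=\iota(p)$ for the position vector. Let $A(X,Y)=\langle\nabla_XN,Y\rangle$ be its second fundamental form and $H=\operatorname{div}N$ its mean curvature (the trace of $A$ with respect to the induced metric), so that the sphere of radius $R$ with outer normal has $H=n/R$. For a function $f$ on $\mathbb R^{n+1}$ and a smooth map $\Phi:M\to\mathbb R^{n+1}$, let $d\mathcal A_f=e^{f\circ\Phi}\,d\mathcal A$ be the weighted $n$-dimensional area measure of $\Phi$ on $M$, where $d\mathcal A=\sqrt{\det(\langle\partial_i\Phi,\partial_j\Phi\rangle)}\,dz$ in charts (area counted with multiplicity), and let $\mathcal A_f(\Phi;K)$ be the measure of a compact set $K\subset M$. Let $C_0^\infty(\Sigma)$ be the space of smooth functions $u:M\to\mathbb R$ with compact support in the interior of $M$. For $u\in C_0^\infty(\Sigma)$ the first variation of the weighted area is $$\delta\mathcal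 A_f(u)=\frac{d}{dt}\Big|_{t=0}\mathcal A_f(\iota+t\,uN;\operatorname{supp}u).$$ Let $f:\mathbb R^{n+1}\to\mathbb R$ be of class $C^1$. Then: (i) The first variation is well defined: for every $u\in C_0^\infty(\Sigma)$, every compact $K\subset M$ and every smooth variation $F:(-\varepsilon,\varepsilon)\times M\to\mathbb R^{n+1}$ with $F(0,\cdot)=\iota$, $F(t,p)=\iota(p)$ for $p\notin K$, and $\partial_tF(0,\cdot)=uN$ (in particular for every such variation with $\partial_t F$ normal to $F(t,M)$ at all times), the function $t\mapsto\mathcal A_f(F(t,\cdot);K)$ is differentiable at $t=0$ with derivative $\delta\mathcal A_f(u)$. (ii) $\delta\mathcal A_f(u)=0$ for all $u\in C_0^\infty(\Sigma)$ with $\int_\Sigma u\,d\mathcal A_f=0$ if and only if $H+\langle\nabla f,N\rangle$ is constant on $\Sigma$. (iii) In particular, for the Gaussian weight $f(x)=-|x|^2/4$, $\delta\mathcal A_f(u)=0$ for all $u\in C_0^\infty(\Sigma)$ with $\int_\Sigma u\,d\mathcal A_f=0$ if and only if there is a constant $C$ with $H=\tfrac12\langle x,N\rangle+C$ on $\Sigma$.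 -/

import Mathlib

open Set MeasureTheory
open scoped Manifold ContDiff Gradient

noncomputable section

namespace WeightedHypersurface

variable {n : ℕ} {H : Type*} [TopologicalSpace H]
  (I : ModelWithCorners ℝ (EuclideanSpace ℝ (Fin n)) H)
  {M : Type*} [TopologicalSpace M] [ChartedSpace H M]

/-- The differential at `p` of a map `Φ : M → ℝⁿ⁺¹`; the tangent space of `M` at `p` is `ℝⁿ`
(with the coordinates of the preferred chart at `p`). -/
def differential (Φ : M → EuclideanSpace ℝ (Fin (n + 1))) (p : M) :
    EuclideanSpace ℝ (Fin n) →L[ℝ] EuclideanSpace ℝ (Fin (n + 1)) :=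
  mfderiv I 𝓘(ℝ, EuclideanSpace ℝ (Fin (n + 1))) Φ p

/-- `ι` is a smooth immersion of the `n`-manifold `M` into `ℝⁿ⁺¹`, and `N` is a smooth unit normal
field along `ι` (so that the hypersurface is two-sided, with a chosen orientation). -/
structure IsTwoSidedHypersurface (ι N : M → EuclideanSpace ℝ (Fin (n + 1))) : Prop where
  smooth : ContMDiff I 𝓘(ℝ, EuclideanSpace ℝ (Fin (n + 1))) ∞ ι
  immersion : ∀ p, Function.Injective (differential I ι p)
  normal_smooth : ContMDiff I 𝓘(ℝ, EuclideanSpace ℝ (Fin (n + 1))) ∞ N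
  normal_unit : ∀ p, ‖N p‖ = 1
  normal_orthogonal : ∀ p v, inner ℝ (N p) (differential I ι p v) = 0

/-- The matrix `g i j = ⟨∂ᵢ ι, ∂ⱼ ι⟩` of the metric induced by `ι`, at `p`. -/
def metricMatrix (ι : M → EuclideanSpace ℝ (Fin (n + 1))) (p : M) :
    Matrix (Fin n) (Fin n) ℝ :=
  Matrix.of fun i j =>
    inner ℝ (differential I ι p (EuclideanSpace.single i 1))
      (differential I ι p (EuclideanSpace.single j 1))

/-- The matrix of the second fundamental form `A(X, Y) = ⟨∇_X N, Y⟩` at `p`. -/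
def secondFundamentalMatrix (ι N : M → EuclideanSpace ℝ (Fin (n + 1))) (p : M) :
    Matrix (Fin n) (Fin n) ℝ :=
  Matrix.of fun i j =>
    inner ℝ (differential I N p (EuclideanSpace.single i 1))
      (differential I ι p (EuclideanSpace.single j 1))

/-- The mean curvature `div N`, the trace `gⁱʲ Aᵢⱼ` of the second fundamental form with respect to
the induced metric. The sphere of radius `R` with its outer normal has mean curvature `n / R`. -/
def meanCurvature (ι N : M → EuclideanSpace ℝ (Fin (n + 1))) (p : M) : ℝ :=
  ((metricMatrix I ι p)⁻¹ * secondFundamentalMatrix I ι N p).trace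

/-- The area density `√det (⟨∂ᵢ Φ, ∂ⱼ Φ⟩)` of `Φ` in the coordinates of the chart at `c`, at the
coordinate point `z`. -/
def areaDensity (Φ : M → EuclideanSpace ℝ (Fin (n + 1))) (c : M)
    (z : EuclideanSpace ℝ (Fin n)) : ℝ :=
  let D := fderivWithin ℝ (Φ ∘ (extChartAt I c).symm) (range I) z
  √(Matrix.of fun i j : Fin n =>
    inner ℝ (D (EuclideanSpace.single i 1)) (D (EuclideanSpace.single j 1))).det

section Area

variable (M) in
/-- A smooth partition of unity subordinate to the domains of the charts of `M`. -/
def chartPartition [IsManifold I ∞ M] [T2Space M] [SigmaCompactSpace M] :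
    SmoothPartitionOfUnity M I M univ :=
  Classical.choose (SmoothPartitionOfUnity.exists_isSubordinate_chartAt_source I M)

variable [IsManifold I ∞ M] [T2Space M] [SigmaCompactSpace M] [MeasurableSpace M]

/-- The `n`-dimensional area of `Φ` (counted with multiplicity), as a measure on `M`: the Riemannian
measure `√det g dz` of the induced metric, glued from the charts by a partition of unity. -/
def areaMeasure (Φ : M → EuclideanSpace ℝ (Fin (n + 1))) : Measure M :=
  Measure.sum fun c : M =>
    ((volume.restrict (extChartAt I c).target).withDensity fun z =>
      ENNReal.ofReal
        (chartPartition I M c ((extChartAt I c).symm z) * areaDensity I Φ c z)).map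
      (extChartAt I c).symm

/-- The weighted area measure `e^f dA` of `Φ`. -/
def weightedAreaMeasure (f : EuclideanSpace ℝ (Fin (n + 1)) → ℝ)
    (Φ : M → EuclideanSpace ℝ (Fin (n + 1))) : Measure M :=
  (areaMeasure I Φ).withDensity fun p => ENNReal.ofReal (Real.exp (f (Φ p)))

/-- The weighted area of the part of `Φ` parametrized by `K`. -/
def weightedArea (f : EuclideanSpace ℝ (Fin (n + 1)) → ℝ) (K : Set M)
    (Φ : M → EuclideanSpace ℝ (Fin (n + 1))) : ℝ :=
  (weightedAreaMeasure I f Φ).real K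

/-- The first variation of the weighted area in the direction `u N`: the derivative at `t = 0` of
the weighted area of `ι + t u N`, measured on the compact set off which nothing moves. -/
def firstVariation (f : EuclideanSpace ℝ (Fin (n + 1)) → ℝ)
    (ι N : M → EuclideanSpace ℝ (Fin (n + 1))) (u : M → ℝ) : ℝ :=
  deriv (fun t : ℝ => weightedArea I f (tsupport u) fun p => ι p + (t * u p) • N p) 0

end Area

/-- The smooth functions with compact support in the interior of `M` (which is all of `M` if `M` has
no boundary). -/
structure IsTestFunction (u : M → ℝ) : Prop where
  smooth : ContMDiff I 𝓘(ℝ) ∞ u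
  compact_support : HasCompactSupport u
  support_interior : tsupport u ⊆ I.interior M

/-- `F` is a smooth variation of `ι`, fixed off the compact set `K`, which at time `0` moves
normally with speed `u`. Variations whose velocity is normal at all times are among these. -/
structure IsNormalVariation (ι N : M → EuclideanSpace ℝ (Fin (n + 1))) (u : M → ℝ) (K : Set M)
    (F : ℝ → M → EuclideanSpace ℝ (Fin (n + 1))) : Prop where
  compact : IsCompact K
  smooth_and_fixed : ∃ ε > 0,
    ContMDiffOn (𝓘(ℝ).prod I) 𝓘(ℝ, EuclideanSpace ℝ (Fin (n + 1))) ∞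
      (fun q : ℝ × M => F q.1 q.2) (Ioo (-ε) ε ×ˢ univ) ∧
    ∀ t ∈ Ioo (-ε) ε, ∀ p ∉ K, F t p = ι p
  initial : ∀ p, F 0 p = ι p
  velocity : ∀ p, deriv (fun t => F t p) 0 = u p • N p

/-- The first variation vanishes on all test functions with weighted mean zero. -/
def IsCriticalForMeanZero [IsManifold I ∞ M] [T2Space M] [SigmaCompactSpace M]
    [MeasurableSpace M] (f : EuclideanSpace ℝ (Fin (n + 1)) → ℝ)
    (ι N : M → EuclideanSpace ℝ (Fin (n + 1))) : Prop :=
  ∀ u : M → ℝ, IsTestFunction I u → ∫ p, u p ∂(weightedAreaMeasure I f ι) = 0 →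
    firstVariation I f ι N u = 0

end WeightedHypersurface

end

/-! ### Linear algebra: derivatives of determinants and of Gram determinants. -/

namespace WeightedHypersurface

open Filter Topology

/-! Every area is measured against the fixed measure `areaMeasure I ι`. A change of coordinates
multiplies a Gram determinant by a squared Jacobian (`gramDet_comp`), so the quotient `areaRatio` of
two area elements is a function on `M`, and the weighted area of `F t` over `K` is the integral over
`K` of `weightedRatio I f ι (F t)` (`weightedArea_eq_setIntegral`).

At each point the time derivative of this integrand is `e^f u (H + ⟨∇f, N⟩)`. Jacobi's formula turns
the derivative of `√det g` into a trace. The velocity of `dF` is `d(uN) = u dN + du ⊗ N`, and its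
second term is orthogonal to tangent vectors, which leaves `u H`; the factor `e^f` contributes `u
⟨∇f, N⟩`. A Lipschitz bound in time, uniform on the compact set `K`, permits differentiation under
the integral. The resulting formula `∫ u (H + ⟨∇f, N⟩) e^f dA` involves the variation only through
`u`, hence the first variation is well defined.

Write `h` for `H + ⟨∇f, N⟩`. If `h` is constant, the formula is a multiple of the weighted mean of
`u`. Conversely, if `h p < m < h q` at interior points, a bump near `p` and a bump near `q` combine
to a `u` of mean zero with `u (m - h) ≥ 0`, not identically zero, which contradicts criticality. The
two points may lie in different components, so connectedness plays no role. Boundary points follow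
from continuity of `h` and density of the interior. -/

theorem differentiable_det (m : Type*) [Fintype m] [DecidableEq m] :
    Differentiable ℝ fun A : m → m → ℝ => (Matrix.of A).det := by
  simp only [Matrix.det_apply, Matrix.of_apply]
  fun_prop

theorem hasDerivAt_det_one_add_smul {m : Type*} [Fintype m] [DecidableEq m] (B : Matrix m m ℝ) :
    HasDerivAt (fun s : ℝ => (1 + s • B).det) B.trace 0 := by
  have h := (Matrix.det (1 + (Polynomial.X : Polynomial ℝ) • B.map Polynomial.C)).hasDerivAt 0
  rw [Matrix.derivative_det_one_add_X_smul] at h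
  refine h.congr_of_eventuallyEq (Eventually.of_forall fun s => ?_)
  simp [eval_det, ← Matrix.smul_eq_mul_diagonal]

/-- Jacobi's formula for the derivative of a determinant. -/
theorem hasDerivAt_det {m : Type*} [Fintype m] [DecidableEq m] {G : ℝ → Matrix m m ℝ}
    {G' : Matrix m m ℝ} {t : ℝ} (hG : ∀ i j, HasDerivAt (fun s => G s i j) (G' i j) t)
    (hdet : (G t).det ≠ 0) :
    HasDerivAt (fun s => (G s).det) ((G t).det * ((G t)⁻¹ * G').trace) t := by
  have hd := (differentiable_det m (G t)).hasFDerivAt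
  have hG1 : HasDerivAt (fun s => (G s : m → m → ℝ)) G' t :=
    hasDerivAt_pi.2 fun i => hasDerivAt_pi.2 fun j => hG i j
  have h1 := hd.comp_hasDerivAt t hG1
  -- By the chain rule only `G t` and `G'` matter, so the curve may be replaced by its tangent line,
  -- along which the determinant factors as `det (G t) * det (1 + s (G t)⁻¹ G')`.
  have hline : HasDerivAt (fun s : ℝ => (fun i j => G t i j + s * G' i j : m → m → ℝ)) G' 0 :=
    hasDerivAt_pi.2 fun i => hasDerivAt_pi.2 fun j => by
      simpa using ((hasDerivAt_id (0 : ℝ)).mul_const (G' i j)).const_add (G t i j)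
  have hd0 : HasFDerivAt (fun A : m → m → ℝ => (Matrix.of A).det)
      (fderiv ℝ (fun A : m → m → ℝ => (Matrix.of A).det) (G t))
      (fun i j => G t i j + (0 : ℝ) * G' i j) := by simpa using hd
  have h2 := hd0.comp_hasDerivAt 0 hline
  have h3 : HasDerivAt (fun s : ℝ => (G t).det * (1 + s • ((G t)⁻¹ * G')).det)
      ((G t).det * ((G t)⁻¹ * G').trace) 0 :=
    (hasDerivAt_det_one_add_smul _).const_mul _
  have h4 : ((fun A : m → m → ℝ => (Matrix.of A).det) ∘
      fun s : ℝ => (fun i j => G t i j + s * G' i j : m → m → ℝ)) =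
      fun s : ℝ => (G t).det * (1 + s • ((G t)⁻¹ * G')).det := by
    funext s
    rw [← Matrix.det_mul, mul_add, mul_one, Matrix.mul_smul, ← mul_assoc,
      Matrix.mul_nonsing_inv _ (isUnit_iff_ne_zero.2 hdet), one_mul]
    rfl
  rw [h4] at h2
  rw [h3.unique h2]
  exact h1

variable {n : ℕ}

/-- The Gram determinant of the images of the standard basis under a linear map. -/
noncomputable def gramDet (D : EuclideanSpace ℝ (Fin n) →L[ℝ] EuclideanSpace ℝ (Fin (n + 1))) : ℝ :=
  (Matrix.of fun i j : Fin n =>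
    inner ℝ (D (EuclideanSpace.single i 1)) (D (EuclideanSpace.single j 1))).det

theorem gramDet_pos {D : EuclideanSpace ℝ (Fin n) →L[ℝ] EuclideanSpace ℝ (Fin (n + 1))}
    (hD : Function.Injective D) : 0 < gramDet D := by
  have hli : LinearIndependent ℝ fun i : Fin n => D (EuclideanSpace.single i 1) := by
    have h := (EuclideanSpace.basisFun (Fin n) ℝ).toBasis.linearIndependent.map'
      (D : EuclideanSpace ℝ (Fin n) →ₗ[ℝ] EuclideanSpace ℝ (Fin (n + 1)))
      (LinearMap.ker_eq_bot.2 hD)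
    have he : (fun i : Fin n => D (EuclideanSpace.single i 1)) =
        D ∘ (EuclideanSpace.basisFun (Fin n) ℝ).toBasis := by
      funext i
      simp
    rw [he]
    exact h
  exact (Matrix.posDef_gram_of_linearIndependent hli).det_pos

/-- The source of chart independence: the Jacobian factor does not involve `D`, so it cancels in
quotients of area elements. -/
theorem gramDet_comp (D : EuclideanSpace ℝ (Fin n) →L[ℝ] EuclideanSpace ℝ (Fin (n + 1)))
    (T : EuclideanSpace ℝ (Fin n) →L[ℝ] EuclideanSpace ℝ (Fin n)) :
    gramDet (D.comp T) =
      (Matrix.of fun k i : Fin n => T (EuclideanSpace.single i 1) k).det ^ 2 * gramDet D := by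
  have hT : ∀ i, T (EuclideanSpace.single i 1) =
      ∑ k, T (EuclideanSpace.single i 1) k • EuclideanSpace.single k (1 : ℝ) := fun i => by
    simpa using ((EuclideanSpace.basisFun (Fin n) ℝ).sum_repr (T (EuclideanSpace.single i 1))).symm
  set A := Matrix.of fun k i : Fin n => T (EuclideanSpace.single i 1) k with hA
  have hg : (Matrix.of fun i j : Fin n => inner ℝ (D.comp T (EuclideanSpace.single i 1))
      (D.comp T (EuclideanSpace.single j 1))) = A.transpose * (Matrix.of fun i j : Fin n =>
      inner ℝ (D (EuclideanSpace.single i 1)) (D (EuclideanSpace.single j 1))) * A := by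
    ext i j
    rw [mul_assoc]
    simp only [Matrix.of_apply, Matrix.mul_apply, Matrix.transpose_apply,
      ContinuousLinearMap.comp_apply]
    rw [hT i, hT j]
    simp only [map_sum, map_smul, sum_inner, inner_sum, real_inner_smul_left,
      real_inner_smul_right, hA, Matrix.of_apply, Finset.mul_sum]
    rw [Finset.sum_comm]
    exact Finset.sum_congr rfl fun k _ => Finset.sum_congr rfl fun l _ => by ring
  rw [gramDet, hg, Matrix.det_mul, Matrix.det_mul, Matrix.det_transpose, gramDet]
  ring

theorem contDiff_gramDet {k : ℕ∞ω} : ContDiff ℝ k (gramDet (n := n)) := by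
  unfold gramDet
  simp only [Matrix.det_apply, Matrix.of_apply]
  refine ContDiff.sum fun σ _ => ContDiff.const_smul _ (contDiff_prod fun i _ => ?_)
  exact ContDiff.inner ℝ (by fun_prop) (by fun_prop)

/-- The derivative of an area element. -/
theorem hasDerivAt_sqrt_gramDet
    {D : ℝ → EuclideanSpace ℝ (Fin n) →L[ℝ] EuclideanSpace ℝ (Fin (n + 1))}
    {D' : EuclideanSpace ℝ (Fin n) → EuclideanSpace ℝ (Fin (n + 1))} {t : ℝ}
    (hD : ∀ v, HasDerivAt (fun s => D s v) (D' v) t) {A : Matrix (Fin n) (Fin n) ℝ}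
    (hA : ∀ i j, inner ℝ (D' (EuclideanSpace.single i 1)) (D t (EuclideanSpace.single j 1)) = A i j)
    (hpos : 0 < gramDet (D t)) :
    HasDerivAt (fun s => √(gramDet (D s))) (√(gramDet (D t)) * ((Matrix.of fun i j : Fin n =>
      inner ℝ (D t (EuclideanSpace.single i 1)) (D t (EuclideanSpace.single j 1)))⁻¹ * A).trace)
      t := by
  set G := fun s => (Matrix.of fun i j : Fin n =>
      inner ℝ (D s (EuclideanSpace.single i 1)) (D s (EuclideanSpace.single j 1))) with hGdef
  have hG : ∀ i j, HasDerivAt (fun s => G s i j) ((A + A.transpose) i j) t := fun i j => by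
    have h := (hD (EuclideanSpace.single i 1)).inner ℝ (hD (EuclideanSpace.single j 1))
    refine h.congr_deriv ?_
    rw [Matrix.add_apply, Matrix.transpose_apply, ← hA, ← hA, real_inner_comm, add_comm]
  have h := (hasDerivAt_det hG hpos.ne').sqrt hpos.ne'
  have hsymm : (G t).transpose = G t := by
    ext i j
    exact real_inner_comm (D t (EuclideanSpace.single i 1)) (D t (EuclideanSpace.single j 1))
  -- The metric changes at the rate `A + Aᵀ`. Since `G t` is symmetric both summands have the same
  -- trace against its inverse, and the resulting 2 cancels the 1/2 from the square root; symmetry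
  -- of `A` itself is not needed.
  have htr : ((G t)⁻¹ * A.transpose).trace = ((G t)⁻¹ * A).trace := by
    rw [← Matrix.trace_transpose, Matrix.transpose_mul, Matrix.transpose_transpose,
      Matrix.transpose_nonsing_inv, hsymm, Matrix.trace_mul_comm]
  refine h.congr_deriv ?_
  rw [mul_add, Matrix.trace_add, htr]
  change _ = √(G t).det * _
  have h1 : 0 < √(G t).det := Real.sqrt_pos.2 hpos
  have h2 : √(G t).det * √(G t).det = (G t).det := Real.mul_self_sqrt hpos.le
  rw [div_eq_iff (by positivity)]
  linear_combination (-2) * ((G t)⁻¹ * A).trace * h2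

end WeightedHypersurface

/-! ### Commuting time and space derivatives; area elements in different charts. -/

namespace WeightedHypersurface

open Filter Topology

/-- The time derivative of the spatial derivative of `G` is the spatial derivative of its velocity,
also at boundary points of the spatial domain. -/
theorem hasDerivAt_fderivWithin_slice {E E' : Type*} [NormedAddCommGroup E] [NormedSpace ℝ E]
    [NormedAddCommGroup E'] [NormedSpace ℝ E'] {G : ℝ × E → E'} {R : Set E} {z : E}
    (hG : ContDiffWithinAt ℝ 2 G (univ ×ˢ R) (0, z)) (hR : UniqueDiffOn ℝ R)
    (hRi : R ⊆ closure (interior R)) (hz : z ∈ R) {w : E → E'}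
    (hw : ∀ z' ∈ R, HasDerivAt (fun t => G (t, z')) (w z') 0) (v : E) :
    HasDerivAt (fun t => fderivWithin ℝ (fun z' => G (t, z')) R z v) (fderivWithin ℝ w R z v) 0 := by
  set S : Set (ℝ × E) := univ ×ˢ R with hS
  have hSu : UniqueDiffOn ℝ S := uniqueDiffOn_univ.prod hR
  have h0 : ((0 : ℝ), z) ∈ S := ⟨mem_univ _, hz⟩
  -- The heart of the argument is equality of mixed derivatives. At a boundary point it survives
  -- because the point is a limit of interior points of the domain.
  have hsymm : IsSymmSndFDerivWithinAt ℝ G S (0, z) := by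
    refine hG.isSymmSndFDerivWithinAt (by simp) hSu ?_ h0
    rw [hS, interior_prod_eq, interior_univ, closure_prod_eq, closure_univ]
    exact ⟨mem_univ _, hRi hz⟩
  set DG := fderivWithin ℝ G S with hDG
  have hDGd : HasFDerivWithinAt DG (fderivWithin ℝ DG S (0, z)) S (0, z) :=
    ((hG.fderivWithin_right (m := 1) hSu (by norm_num) h0).differentiableWithinAt
      (by norm_num)).hasFDerivWithinAt
  have hev : ∀ᶠ q in 𝓝[S] ((0 : ℝ), z), HasFDerivWithinAt G (DG q) S q := by
    have h := hG.eventually (by simp)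
    rw [insert_eq_of_mem h0] at h
    filter_upwards [h] with q hq using (hq.differentiableWithinAt (by norm_num)).hasFDerivWithinAt
  have hin_t : Tendsto (fun t : ℝ => (t, z)) (𝓝 0) (𝓝[S] ((0 : ℝ), z)) :=
    tendsto_nhdsWithin_iff.2 ⟨(Continuous.prodMk_left z).tendsto' 0 _ rfl,
      Eventually.of_forall fun t => ⟨mem_univ _, hz⟩⟩
  have hin_z : Tendsto (fun z' : E => ((0 : ℝ), z')) (𝓝[R] z) (𝓝[S] ((0 : ℝ), z)) :=
    tendsto_nhdsWithin_iff.2 ⟨((Continuous.prodMk_right (0 : ℝ)).tendsto z).mono_left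
      nhdsWithin_le_nhds, eventually_mem_nhdsWithin.mono fun z' hz' => ⟨mem_univ _, hz'⟩⟩
  -- Both sides are expressed by the total derivative `DG`: direction `(0, v)` gives the spatial
  -- derivative, direction `(1, 0)` the velocity.
  have hslice : ∀ᶠ t in 𝓝 (0 : ℝ), fderivWithin ℝ (fun z' => G (t, z')) R z v = DG (t, z) (0, v) := by
    filter_upwards [hin_t.eventually hev] with t ht
    have h1 : HasFDerivWithinAt (fun z' : E => (t, z')) (ContinuousLinearMap.inr ℝ ℝ E) R z :=
      (hasFDerivAt_prodMk_right t z).hasFDerivWithinAt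
    have h2 := ht.comp z h1 fun z' hz' => ⟨mem_univ _, hz'⟩
    have h3 : fderivWithin ℝ (fun z' => G (t, z')) R z = _ := h2.fderivWithin (hR z hz)
    rw [h3]
    simp
  have hvel : ∀ᶠ z' in 𝓝[R] z, w z' = DG (0, z') (1, 0) := by
    filter_upwards [hin_z.eventually hev, eventually_mem_nhdsWithin] with z' h hz'
    have h1 : HasFDerivWithinAt (fun t : ℝ => (t, z')) (ContinuousLinearMap.inl ℝ ℝ E) univ 0 :=
      (hasFDerivAt_prodMk_left (0 : ℝ) z').hasFDerivWithinAt
    have h2 := h.comp 0 h1 fun t _ => mk_mem_prod (mem_univ t) hz'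
    have h3 := (hasFDerivWithinAt_univ.1 h2).hasDerivAt
    simpa using (hw z' hz').unique h3
  have hvel0 : w z = DG (0, z) (1, 0) := hvel.self_of_nhdsWithin hz
  have hwd : fderivWithin ℝ w R z v = fderivWithin ℝ DG S (0, z) (0, v) (1, 0) := by
    have h1 : HasFDerivWithinAt (fun z' : E => ((0 : ℝ), z')) (ContinuousLinearMap.inr ℝ ℝ E) R z :=
      (hasFDerivAt_prodMk_right (0 : ℝ) z).hasFDerivWithinAt
    have h2 := (hDGd.comp z h1 fun z' hz' => ⟨mem_univ _, hz'⟩).clm_apply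
      (hasFDerivWithinAt_const ((1 : ℝ), (0 : E)) z R)
    have h3 := h2.congr_of_eventuallyEq hvel hvel0
    rw [h3.fderivWithin (hR z hz)]
    simp
  have htd : HasDerivAt (fun t => DG (t, z) (0, v)) (fderivWithin ℝ DG S (0, z) (1, 0) (0, v)) 0 := by
    have h1 : HasFDerivWithinAt (fun t : ℝ => (t, z)) (ContinuousLinearMap.inl ℝ ℝ E) univ 0 :=
      (hasFDerivAt_prodMk_left (0 : ℝ) z).hasFDerivWithinAt
    have h2 := (hDGd.comp 0 h1 fun t _ => mk_mem_prod (mem_univ t) hz).clm_apply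
      (hasFDerivWithinAt_const ((0 : ℝ), v) 0 univ)
    simpa using (hasFDerivWithinAt_univ.1 h2).hasDerivAt
  rw [hwd, hsymm.eq]
  exact htd.congr_of_eventuallyEq hslice

variable {n : ℕ} {H : Type*} [TopologicalSpace H]
  (I : ModelWithCorners ℝ (EuclideanSpace ℝ (Fin n)) H)
  {M : Type*} [TopologicalSpace M] [ChartedSpace H M]

theorem areaDensity_eq (Φ : M → EuclideanSpace ℝ (Fin (n + 1))) (c : M)
    (z : EuclideanSpace ℝ (Fin n)) :
    areaDensity I Φ c z =
      √(gramDet (fderivWithin ℝ (Φ ∘ (extChartAt I c).symm) (range I) z)) := rfl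

/-- The ratio of the area elements of `Φ` and `ι`, a function on the manifold. -/
noncomputable def areaRatio (ι Φ : M → EuclideanSpace ℝ (Fin (n + 1))) (p : M) : ℝ :=
  √(gramDet (differential I Φ p)) / √(gramDet (differential I ι p))

theorem areaRatio_nonneg (ι Φ : M → EuclideanSpace ℝ (Fin (n + 1))) (p : M) :
    0 ≤ areaRatio I ι Φ p := by
  unfold areaRatio
  positivity

/-- The differential at `z` of the inverse of the chart at `c`, in the coordinates of the preferred
chart at the image of `z`. -/
noncomputable def chartSymmDifferential (c : M) (z : EuclideanSpace ℝ (Fin n)) :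
    EuclideanSpace ℝ (Fin n) →L[ℝ] EuclideanSpace ℝ (Fin n) :=
  mfderivWithin 𝓘(ℝ, EuclideanSpace ℝ (Fin n)) I (extChartAt I c).symm (range I) z

variable [IsManifold I ∞ M]

theorem chartSymmDifferential_injective {c : M} {z : EuclideanSpace ℝ (Fin n)}
    (hz : z ∈ (extChartAt I c).target) : Function.Injective (chartSymmDifferential I c z) :=
  (isInvertible_mfderivWithin_extChartAt_symm hz).injective

theorem fderivWithin_comp_extChartAt_symm {Φ : M → EuclideanSpace ℝ (Fin (n + 1))} {c : M}
    {z : EuclideanSpace ℝ (Fin n)} (hz : z ∈ (extChartAt I c).target)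
    (hΦ : MDifferentiableAt I 𝓘(ℝ, EuclideanSpace ℝ (Fin (n + 1))) Φ ((extChartAt I c).symm z)) :
    fderivWithin ℝ (Φ ∘ (extChartAt I c).symm) (range I) z =
      (differential I Φ ((extChartAt I c).symm z)).comp (chartSymmDifferential I c z) := by
  rw [← mfderivWithin_eq_fderivWithin]
  exact mfderiv_comp_mfderivWithin z hΦ (mdifferentiableWithinAt_extChartAt_symm hz)
    (I.uniqueDiffOn z (extChartAt_target_subset_range c hz)).uniqueMDiffWithinAt

theorem areaDensity_pos {ι : M → EuclideanSpace ℝ (Fin (n + 1))}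
    (hι : ContMDiff I 𝓘(ℝ, EuclideanSpace ℝ (Fin (n + 1))) ∞ ι)
    (hinj : ∀ p, Function.Injective (differential I ι p)) {c : M}
    {z : EuclideanSpace ℝ (Fin n)} (hz : z ∈ (extChartAt I c).target) :
    0 < areaDensity I ι c z := by
  rw [areaDensity_eq, fderivWithin_comp_extChartAt_symm I hz
    (hι.mdifferentiableAt (by simp))]
  refine Real.sqrt_pos.2 (gramDet_pos ?_)
  exact (hinj _).comp (chartSymmDifferential_injective I hz)

/-- Both densities at `z` carry the same Jacobian of the inverse chart relative to the preferred
chart, so their quotient is the one computed in the preferred chart. -/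
theorem areaRatio_mul_areaDensity {ι Φ : M → EuclideanSpace ℝ (Fin (n + 1))}
    (hι : ContMDiff I 𝓘(ℝ, EuclideanSpace ℝ (Fin (n + 1))) ∞ ι)
    (hinj : ∀ p, Function.Injective (differential I ι p))
    (hΦ : MDifferentiable I 𝓘(ℝ, EuclideanSpace ℝ (Fin (n + 1))) Φ) {c : M}
    {z : EuclideanSpace ℝ (Fin n)} (hz : z ∈ (extChartAt I c).target) :
    areaRatio I ι Φ ((extChartAt I c).symm z) * areaDensity I ι c z = areaDensity I Φ c z := by
  rw [areaDensity_eq, areaDensity_eq, fderivWithin_comp_extChartAt_symm I hz (hΦ _),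
    fderivWithin_comp_extChartAt_symm I hz (hι.mdifferentiableAt (by simp))]
  rw [gramDet_comp, gramDet_comp, Real.sqrt_mul (sq_nonneg _), Real.sqrt_mul (sq_nonneg _), areaRatio]
  have h := Real.sqrt_pos.2 (gramDet_pos (hinj ((extChartAt I c).symm z)))
  field_simp

theorem areaRatio_eq_div {ι Φ : M → EuclideanSpace ℝ (Fin (n + 1))}
    (hι : ContMDiff I 𝓘(ℝ, EuclideanSpace ℝ (Fin (n + 1))) ∞ ι)
    (hinj : ∀ p, Function.Injective (differential I ι p))
    (hΦ : MDifferentiable I 𝓘(ℝ, EuclideanSpace ℝ (Fin (n + 1))) Φ) {c : M}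
    {z : EuclideanSpace ℝ (Fin n)} (hz : z ∈ (extChartAt I c).target) :
    areaRatio I ι Φ ((extChartAt I c).symm z) = areaDensity I Φ c z / areaDensity I ι c z := by
  rw [eq_div_iff (areaDensity_pos I hι hinj hz).ne', areaRatio_mul_areaDensity I hι hinj hΦ hz]

end WeightedHypersurface

/-! ### Smooth families: regularity and time derivative of the weighted area element. -/

namespace WeightedHypersurface

open Filter Topology

variable {n : ℕ} {H : Type*} [TopologicalSpace H]
  (I : ModelWithCorners ℝ (EuclideanSpace ℝ (Fin n)) H)
  {M : Type*} [TopologicalSpace M] [ChartedSpace H M]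

theorem differential_eq_fderivWithin {Φ : M → EuclideanSpace ℝ (Fin (n + 1))} {p : M}
    (hΦ : MDifferentiableAt I 𝓘(ℝ, EuclideanSpace ℝ (Fin (n + 1))) Φ p) :
    differential I Φ p =
      fderivWithin ℝ (Φ ∘ (extChartAt I p).symm) (range I) (extChartAt I p p) := by
  rw [differential, hΦ.mfderiv]
  rfl

/-- The weighted area element of `Φ`, relative to the area element of `ι`. -/
noncomputable def weightedRatio (f : EuclideanSpace ℝ (Fin (n + 1)) → ℝ)
    (ι Φ : M → EuclideanSpace ℝ (Fin (n + 1))) (p : M) : ℝ :=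
  Real.exp (f (Φ p)) * areaRatio I ι Φ p

theorem weightedRatio_nonneg (f : EuclideanSpace ℝ (Fin (n + 1)) → ℝ)
    (ι Φ : M → EuclideanSpace ℝ (Fin (n + 1))) (p : M) : 0 ≤ weightedRatio I f ι Φ p :=
  mul_nonneg (Real.exp_pos _).le (areaRatio_nonneg I ι Φ p)

/-- A family of maps `F t`, smooth in `(t, p)` for small `t`, which starts at `ι`. -/
structure IsSmoothFamily (ι : M → EuclideanSpace ℝ (Fin (n + 1)))
    (F : ℝ → M → EuclideanSpace ℝ (Fin (n + 1))) (ε : ℝ) : Prop where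
  pos : 0 < ε
  smooth : ContMDiffOn (𝓘(ℝ).prod I) 𝓘(ℝ, EuclideanSpace ℝ (Fin (n + 1))) ∞
      (fun q : ℝ × M => F q.1 q.2) (Ioo (-ε) ε ×ˢ univ)
  initial : F 0 = ι

namespace IsSmoothFamily

variable {I} {ι : M → EuclideanSpace ℝ (Fin (n + 1))}
  {F : ℝ → M → EuclideanSpace ℝ (Fin (n + 1))} {ε : ℝ}

theorem contMDiffAt (h : IsSmoothFamily I ι F ε) {t : ℝ} (ht : t ∈ Ioo (-ε) ε) (p : M) :
    ContMDiffAt (𝓘(ℝ).prod I) 𝓘(ℝ, EuclideanSpace ℝ (Fin (n + 1))) ∞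
      (fun q : ℝ × M => F q.1 q.2) (t, p) :=
  h.smooth.contMDiffAt (prod_mem_nhds (Ioo_mem_nhds ht.1 ht.2) univ_mem)

theorem zero_mem (h : IsSmoothFamily I ι F ε) : (0 : ℝ) ∈ Ioo (-ε) ε :=
  ⟨by linarith [h.pos], h.pos⟩

theorem contMDiff (h : IsSmoothFamily I ι F ε) {t : ℝ} (ht : t ∈ Ioo (-ε) ε) :
    ContMDiff I 𝓘(ℝ, EuclideanSpace ℝ (Fin (n + 1))) ∞ (F t) := fun p =>
  (h.contMDiffAt ht p).comp p (contMDiffAt_const.prodMk contMDiffAt_id)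

theorem mdifferentiable (h : IsSmoothFamily I ι F ε) {t : ℝ} (ht : t ∈ Ioo (-ε) ε) :
    MDifferentiable I 𝓘(ℝ, EuclideanSpace ℝ (Fin (n + 1))) (F t) :=
  (h.contMDiff ht).mdifferentiable (by simp)

theorem eventually_mem (h : IsSmoothFamily I ι F ε) : ∀ᶠ t in 𝓝 (0 : ℝ), t ∈ Ioo (-ε) ε :=
  Ioo_mem_nhds h.zero_mem.1 h.zero_mem.2

theorem differentiableAt (h : IsSmoothFamily I ι F ε) (p : M) :
    DifferentiableAt ℝ (fun t => F t p) 0 := by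
  have h1 : ContMDiffAt 𝓘(ℝ) 𝓘(ℝ, EuclideanSpace ℝ (Fin (n + 1))) ∞ (fun t => F t p) 0 :=
    (h.contMDiffAt h.zero_mem p).comp (0 : ℝ) (contMDiffAt_id.prodMk contMDiffAt_const)
  exact h1.contDiffAt.differentiableAt (by simp)

variable [IsManifold I ∞ M]

theorem contDiffWithinAt (h : IsSmoothFamily I ι F ε) {c : M} {z : EuclideanSpace ℝ (Fin n)}
    (hz : z ∈ (extChartAt I c).target) :
    ContDiffWithinAt ℝ ∞ (fun q : ℝ × EuclideanSpace ℝ (Fin n) =>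
      F q.1 ((extChartAt I c).symm q.2)) (univ ×ˢ range I) (0, z) := by
  rw [← contMDiffWithinAt_iff_contDiffWithinAt]
  have h1 : ContMDiffWithinAt 𝓘(ℝ, ℝ × EuclideanSpace ℝ (Fin n)) I ∞
      (fun q : ℝ × EuclideanSpace ℝ (Fin n) => (extChartAt I c).symm q.2)
      (univ ×ˢ range I) (0, z) :=
    (contMDiffWithinAt_extChartAt_symm_range c hz).comp (t := range I) ((0 : ℝ), z)
      contDiff_snd.contMDiff.contMDiffAt.contMDiffWithinAt fun q hq => hq.2
  have h2 : ContMDiffWithinAt 𝓘(ℝ, ℝ × EuclideanSpace ℝ (Fin n)) 𝓘(ℝ) ∞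
      (fun q : ℝ × EuclideanSpace ℝ (Fin n) => q.1) (univ ×ˢ range I) (0, z) :=
    contDiff_fst.contMDiff.contMDiffAt.contMDiffWithinAt
  exact ContMDiffAt.comp_contMDiffWithinAt
    (g := fun q : ℝ × M => F q.1 q.2) ((0 : ℝ), z)
    (h.contMDiffAt h.zero_mem _) (h2.prodMk h1)

/-- The square root is smooth only where the Gram determinant is positive. This is known at time 0,
where the family is the immersion `ι`, and that suffices for a statement at `(0, z)`. -/
theorem contDiffWithinAt_areaDensity (h : IsSmoothFamily I ι F ε)
    (hι : ContMDiff I 𝓘(ℝ, EuclideanSpace ℝ (Fin (n + 1))) ∞ ι)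
    (hinj : ∀ p, Function.Injective (differential I ι p)) {c : M} {z : EuclideanSpace ℝ (Fin n)}
    (hz : z ∈ (extChartAt I c).target) :
    ContDiffWithinAt ℝ 1 (fun q : ℝ × EuclideanSpace ℝ (Fin n) => areaDensity I (F q.1) c q.2)
      (univ ×ˢ range I) (0, z) := by
  have hzr : z ∈ range I := extChartAt_target_subset_range c hz
  -- The pair `(t, z)` serves as parameter and a separate variable `z'` is differentiated, then set
  -- equal to `z`.
  have h1 : ContDiffWithinAt ℝ 2 (Function.uncurry fun (q : ℝ × EuclideanSpace ℝ (Fin n))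
      (z' : EuclideanSpace ℝ (Fin n)) => F q.1 ((extChartAt I c).symm z'))
      ((univ ×ˢ range I) ×ˢ range I) ((0, z), z) := by
    have h2 := (h.contDiffWithinAt hz).of_le (m := 2) (by norm_cast)
    refine ContDiffWithinAt.comp (t := univ ×ˢ range I) (g := fun q : ℝ × EuclideanSpace ℝ (Fin n) =>
      F q.1 ((extChartAt I c).symm q.2))
      (f := fun q : (ℝ × EuclideanSpace ℝ (Fin n)) × EuclideanSpace ℝ (Fin n) => (q.1.1, q.2))
      ((0, z), z) h2 (by fun_prop) fun q hq => ⟨mem_univ _, hq.2⟩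
  have hD := h1.fderivWithin (m := 1) (g := fun q : ℝ × EuclideanSpace ℝ (Fin n) => q.2)
    contDiffWithinAt_snd I.uniqueDiffOn (by norm_num) ⟨mem_univ _, hzr⟩ fun q hq => hq.2
  refine (contDiff_gramDet.contDiffAt.comp_contDiffWithinAt _ hD).sqrt ?_
  have hp := areaDensity_pos I hι hinj hz
  rw [areaDensity_eq, Real.sqrt_pos] at hp
  rw [← h.initial] at hp
  exact hp.ne'

end IsSmoothFamily

variable {I} in
-- Regarding `ι` as a constant family gives the regularity of the denominator in
-- `contDiffWithinAt_weightedDensity`.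
theorem isSmoothFamily_const {ι : M → EuclideanSpace ℝ (Fin (n + 1))}
    (hι : ContMDiff I 𝓘(ℝ, EuclideanSpace ℝ (Fin (n + 1))) ∞ ι) :
    IsSmoothFamily I ι (fun _ => ι) 1 where
  pos := one_pos
  smooth := (hι.comp contMDiff_snd).contMDiffOn
  initial := rfl

variable {I} in
theorem isSmoothFamily_add_smul {ι N : M → EuclideanSpace ℝ (Fin (n + 1))} {u : M → ℝ}
    (hι : ContMDiff I 𝓘(ℝ, EuclideanSpace ℝ (Fin (n + 1))) ∞ ι)
    (hN : ContMDiff I 𝓘(ℝ, EuclideanSpace ℝ (Fin (n + 1))) ∞ N) (hu : ContMDiff I 𝓘(ℝ) ∞ u) :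
    IsSmoothFamily I ι (fun t p => ι p + (t * u p) • N p) 1 where
  pos := one_pos
  smooth := by
    refine ContMDiff.contMDiffOn ?_
    exact (hι.comp contMDiff_snd).add
      ((contMDiff_fst.mul (hu.comp contMDiff_snd)).smul (hN.comp contMDiff_snd))
  initial := by simp

theorem areaRatio_self {ι : M → EuclideanSpace ℝ (Fin (n + 1))}
    (hinj : ∀ p, Function.Injective (differential I ι p)) (p : M) : areaRatio I ι ι p = 1 :=
  div_self (Real.sqrt_pos.2 (gramDet_pos (hinj p))).ne'

namespace IsSmoothFamily

variable {I} {ι : M → EuclideanSpace ℝ (Fin (n + 1))}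
  {F : ℝ → M → EuclideanSpace ℝ (Fin (n + 1))} {ε : ℝ} [IsManifold I ∞ M]

theorem contDiffWithinAt_weightedDensity (h : IsSmoothFamily I ι F ε)
    (hι : ContMDiff I 𝓘(ℝ, EuclideanSpace ℝ (Fin (n + 1))) ∞ ι)
    (hinj : ∀ p, Function.Injective (differential I ι p))
    {f : EuclideanSpace ℝ (Fin (n + 1)) → ℝ} (hf : ContDiff ℝ 1 f)
    {c : M} {z : EuclideanSpace ℝ (Fin n)} (hz : z ∈ (extChartAt I c).target) :
    ContDiffWithinAt ℝ 1 (fun q : ℝ × EuclideanSpace ℝ (Fin n) =>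
      Real.exp (f (F q.1 ((extChartAt I c).symm q.2))) *
        (areaDensity I (F q.1) c q.2 / areaDensity I ι c q.2)) (univ ×ˢ range I) (0, z) := by
  have h1 := (h.contDiffWithinAt hz).of_le (m := 1) (by exact_mod_cast le_top)
  refine (hf.contDiffAt.comp_contDiffWithinAt _ h1).exp.mul ?_
  exact (h.contDiffWithinAt_areaDensity hι hinj hz).div
    ((isSmoothFamily_const hι).contDiffWithinAt_areaDensity hι hinj hz)
    (areaDensity_pos I hι hinj hz).ne'

theorem weightedRatio_eq (h : IsSmoothFamily I ι F ε)
    (hι : ContMDiff I 𝓘(ℝ, EuclideanSpace ℝ (Fin (n + 1))) ∞ ι)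
    (hinj : ∀ p, Function.Injective (differential I ι p))
    (f : EuclideanSpace ℝ (Fin (n + 1)) → ℝ) {t : ℝ} (ht : t ∈ Ioo (-ε) ε) {c p : M}
    (hp : p ∈ (extChartAt I c).source) :
    weightedRatio I f ι (F t) p =
      Real.exp (f (F t ((extChartAt I c).symm (extChartAt I c p)))) *
        (areaDensity I (F t) c (extChartAt I c p) / areaDensity I ι c (extChartAt I c p)) := by
  rw [← areaRatio_eq_div I hι hinj (h.mdifferentiable ht) ((extChartAt I c).map_source hp),
    (extChartAt I c).left_inv hp]
  rfl

/-- The weighted area elements of a smooth family are Lipschitz in time, locally uniformly on the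
manifold. -/
theorem exists_lipschitz (h : IsSmoothFamily I ι F ε)
    (hι : ContMDiff I 𝓘(ℝ, EuclideanSpace ℝ (Fin (n + 1))) ∞ ι)
    (hinj : ∀ p, Function.Injective (differential I ι p))
    {f : EuclideanSpace ℝ (Fin (n + 1)) → ℝ} (hf : ContDiff ℝ 1 f) (c : M) :
    ∃ C : NNReal, ∃ δ > 0, ∃ V ∈ 𝓝 c,
      ∀ p ∈ V, LipschitzOnWith C (fun t => weightedRatio I f ι (F t) p) (Ioo (-δ) δ) := by
  -- A `C¹` function is Lipschitz near a point of a convex set; convexity of `range I` covers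
  -- boundary and corners. For a fixed point of `M` only the time coordinate then varies.
  obtain ⟨C, T, hT, hlip⟩ := (h.contDiffWithinAt_weightedDensity hι hinj hf
    (mem_extChartAt_target c)).exists_lipschitzOnWith (convex_univ.prod I.convex_range)
  rw [nhdsWithin_prod_eq, nhdsWithin_univ] at hT
  obtain ⟨A, hA, W, hW, hAW⟩ := Filter.mem_prod_iff.1 hT
  obtain ⟨δ, hδ, hδA⟩ := Metric.mem_nhds_iff.1 (inter_mem hA h.eventually_mem)
  rw [Real.ball_eq_Ioo, zero_sub, zero_add] at hδA
  rw [← map_extChartAt_nhds] at hW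
  refine ⟨C, δ, hδ, extChartAt I c ⁻¹' W ∩ (extChartAt I c).source,
    inter_mem hW (extChartAt_source_mem_nhds c), fun p hp t ht s hs => ?_⟩
  beta_reduce
  rw [h.weightedRatio_eq hι hinj f (hδA ht).2 hp.2, h.weightedRatio_eq hι hinj f (hδA hs).2 hp.2]
  refine (hlip (hAW (mk_mem_prod (hδA ht).1 hp.1)) (hAW (mk_mem_prod (hδA hs).1 hp.1))).trans_eq ?_
  simp [Prod.edist_eq]

/-- The time derivative at `0` of the weighted area elements is continuous on the manifold. -/
theorem continuous_deriv_weightedRatio (h : IsSmoothFamily I ι F ε)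
    (hι : ContMDiff I 𝓘(ℝ, EuclideanSpace ℝ (Fin (n + 1))) ∞ ι)
    (hinj : ∀ p, Function.Injective (differential I ι p))
    {f : EuclideanSpace ℝ (Fin (n + 1)) → ℝ} (hf : ContDiff ℝ 1 f) :
    Continuous fun p => deriv (fun t => weightedRatio I f ι (F t) p) 0 := by
  refine continuous_iff_continuousAt.2 fun c => ?_
  set q : ℝ × EuclideanSpace ℝ (Fin n) → ℝ := fun q =>
      Real.exp (f (F q.1 ((extChartAt I c).symm q.2))) *
        (areaDensity I (F q.1) c q.2 / areaDensity I ι c q.2) with hq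
  -- The variables are swapped so that time is differentiated and the chart coordinate is the
  -- parameter; one derivative is spent, which leaves continuity in `z`.
  have h1 : ContDiffWithinAt ℝ 1 (Function.uncurry fun (z : EuclideanSpace ℝ (Fin n)) (t : ℝ) =>
      q (t, z)) (range I ×ˢ univ) (extChartAt I c c, 0) := by
    refine ContDiffWithinAt.comp (t := univ ×ˢ range I) (g := q)
      (f := fun r : EuclideanSpace ℝ (Fin n) × ℝ => (r.2, r.1)) (extChartAt I c c, 0)
      (h.contDiffWithinAt_weightedDensity hι hinj hf (mem_extChartAt_target c)) (by fun_prop)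
      fun r hr => ⟨mem_univ _, hr.1⟩
  have h2 := (h1.fderivWithin (m := 0) (g := fun _ => (0 : ℝ)) contDiffWithinAt_const
    uniqueDiffOn_univ (by norm_num) (mem_range_self _)
    fun _ _ => mem_univ _).continuousWithinAt.clm_apply (continuousWithinAt_const (b := (1 : ℝ)))
  have h3 : Tendsto (fun p => deriv (fun t => q (t, extChartAt I c p)) 0) (𝓝 c)
      (𝓝 (deriv (fun t => q (t, extChartAt I c c)) 0)) := by
    have h4 : Tendsto (extChartAt I c) (𝓝 c) (𝓝[range I] (extChartAt I c c)) :=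
      (map_extChartAt_nhds c).le
    simpa [fderivWithin_univ, Function.comp_def] using h2.tendsto.comp h4
  have h5 : ∀ p ∈ (extChartAt I c).source, deriv (fun t => weightedRatio I f ι (F t) p) 0 =
      deriv (fun t => q (t, extChartAt I c p)) 0 := fun p hp => by
    refine Filter.EventuallyEq.deriv_eq ?_
    filter_upwards [h.eventually_mem] with t ht
    exact h.weightedRatio_eq hι hinj f ht hp
  unfold ContinuousAt
  beta_reduce
  rw [h5 c (mem_extChartAt_source c)]
  refine h3.congr' ?_
  filter_upwards [extChartAt_source_mem_nhds (I := I) c] with p hp using (h5 p hp).symm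

/-- In `d(uN) = u dN + du ⊗ N` the second term pairs to zero with tangent vectors, so the matrix
entering `hasDerivAt_sqrt_gramDet` is `u` times the second fundamental form. -/
theorem hasDerivAt_areaRatio (h : IsSmoothFamily I ι F ε) {N : M → EuclideanSpace ℝ (Fin (n + 1))}
    (hS : IsTwoSidedHypersurface I ι N) {u : M → ℝ} (hu : ContMDiff I 𝓘(ℝ) ∞ u)
    (hv : ∀ p, HasDerivAt (fun t => F t p) (u p • N p) 0) (p : M) :
    HasDerivAt (fun t => areaRatio I ι (F t) p) (u p * meanCurvature I ι N p) 0 := by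
  have hzr : extChartAt I p p ∈ range I :=
    extChartAt_target_subset_range p (mem_extChartAt_target p)
  have hpos := gramDet_pos (hS.immersion p)
  have hD : ∀ v, HasDerivAt (fun t => differential I (F t) p v)
      (fderivWithin ℝ (fun z => u ((extChartAt I p).symm z) • N ((extChartAt I p).symm z))
        (range I) (extChartAt I p p) v) 0 := fun v => by
    have h1 := hasDerivAt_fderivWithin_slice
      ((h.contDiffWithinAt (mem_extChartAt_target p)).of_le (m := 2) (by norm_cast))
      I.uniqueDiffOn I.range_subset_closure_interior hzr
      (w := fun z => u ((extChartAt I p).symm z) • N ((extChartAt I p).symm z))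
      (fun z _ => hv ((extChartAt I p).symm z)) v
    refine h1.congr_of_eventuallyEq ?_
    filter_upwards [h.eventually_mem] with t ht
    rw [differential_eq_fderivWithin I (h.mdifferentiable ht p)]
    rfl
  have hsymm : ContMDiffWithinAt 𝓘(ℝ, EuclideanSpace ℝ (Fin n)) I ∞ (extChartAt I p).symm
    (range I) (extChartAt I p p) := contMDiffWithinAt_extChartAt_symm_range p (mem_extChartAt_target p)
  have hud : DifferentiableWithinAt ℝ (fun z => u ((extChartAt I p).symm z)) (range I)
      (extChartAt I p p) :=
    (contMDiffWithinAt_iff_contDiffWithinAt.1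
      (hu.contMDiffAt.comp_contMDiffWithinAt _ hsymm)).differentiableWithinAt (by simp)
  have hNd : DifferentiableWithinAt ℝ (fun z => N ((extChartAt I p).symm z)) (range I)
      (extChartAt I p p) :=
    (contMDiffWithinAt_iff_contDiffWithinAt.1
      (hS.normal_smooth.contMDiffAt.comp_contMDiffWithinAt _ hsymm)).differentiableWithinAt (by simp)
  have hA : ∀ i j, inner ℝ (fderivWithin ℝ
      (fun z => u ((extChartAt I p).symm z) • N ((extChartAt I p).symm z))
        (range I) (extChartAt I p p) (EuclideanSpace.single i 1))
      (differential I (F 0) p (EuclideanSpace.single j 1)) =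
      (u p • secondFundamentalMatrix I ι N p) i j := fun i j => by
    rw [fderivWithin_fun_smul (I.uniqueDiffOn _ hzr) hud hNd, h.initial]
    have hdN := differential_eq_fderivWithin I (hS.normal_smooth.mdifferentiableAt (x := p) (by simp))
    simp only [add_apply, smul_apply,
      ContinuousLinearMap.smulRight_apply, inner_add_left, real_inner_smul_left,
      extChartAt_to_inv, hS.normal_orthogonal, mul_zero, add_zero, Matrix.smul_apply, smul_eq_mul]
    rw [secondFundamentalMatrix, Matrix.of_apply, hdN]
    rfl
  have h1 := (hasDerivAt_sqrt_gramDet hD hA (by rw [h.initial]; exact hpos)).div_const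
    (√(gramDet (differential I ι p)))
  refine h1.congr_deriv ?_
  rw [h.initial, Matrix.mul_smul, Matrix.trace_smul, mul_div_assoc, mul_comm,
    div_mul_cancel₀ _ (Real.sqrt_pos.2 hpos).ne']
  rfl

theorem hasDerivAt_weightedRatio (h : IsSmoothFamily I ι F ε)
    {N : M → EuclideanSpace ℝ (Fin (n + 1))}
    (hS : IsTwoSidedHypersurface I ι N) {u : M → ℝ} (hu : ContMDiff I 𝓘(ℝ) ∞ u)
    (hv : ∀ p, HasDerivAt (fun t => F t p) (u p • N p) 0)
    {f : EuclideanSpace ℝ (Fin (n + 1)) → ℝ} (hf : ContDiff ℝ 1 f) (p : M) :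
    HasDerivAt (fun t => weightedRatio I f ι (F t) p)
      (Real.exp (f (ι p)) * (u p * (meanCurvature I ι N p + inner ℝ (∇ f (ι p)) (N p)))) 0 := by
  have hfd : HasFDerivAt f (fderiv ℝ f (ι p)) (F 0 p) := by
    rw [h.initial]
    exact (hf.differentiable (by norm_num) (ι p)).hasFDerivAt
  have h1 := ((hfd.comp_hasDerivAt (0 : ℝ) (hv p)).exp).mul (h.hasDerivAt_areaRatio hS hu hv p)
  refine h1.congr_deriv ?_
  simp only [Function.comp_apply]
  rw [h.initial, areaRatio_self I hS.immersion, inner_gradient_left, map_smul, smul_eq_mul]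
  ring

end IsSmoothFamily

/-- The function `H + ⟨∇f, N⟩` on the hypersurface. -/
noncomputable def weightedMeanCurvature (f : EuclideanSpace ℝ (Fin (n + 1)) → ℝ)
    (ι N : M → EuclideanSpace ℝ (Fin (n + 1))) (p : M) : ℝ :=
  meanCurvature I ι N p + inner ℝ (∇ f (ι p)) (N p)

/-- Continuity is read off from the variation with `u = 1`: its weighted area element has time
derivative `e^f (H + ⟨∇f, N⟩)`, already known to be continuous. No compact support is needed for
this pointwise argument. -/
theorem continuous_weightedMeanCurvature [IsManifold I ∞ M]
    {ι N : M → EuclideanSpace ℝ (Fin (n + 1))} (hS : IsTwoSidedHypersurface I ι N)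
    {f : EuclideanSpace ℝ (Fin (n + 1)) → ℝ} (hf : ContDiff ℝ 1 f) :
    Continuous (weightedMeanCurvature I f ι N) := by
  have hu : ContMDiff I 𝓘(ℝ) ∞ (fun _ : M => (1 : ℝ)) := contMDiff_const
  have hF := isSmoothFamily_add_smul hS.smooth hS.normal_smooth hu
  have hv : ∀ p, HasDerivAt (fun t : ℝ => ι p + (t * 1) • N p) ((1 : ℝ) • N p) 0 := fun p => by
    simpa using (((hasDerivAt_id (0 : ℝ)).mul_const 1).smul_const (N p)).const_add (ι p)
  have h1 := hF.continuous_deriv_weightedRatio hS.smooth hS.immersion hf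
  have h2 : Continuous fun p => Real.exp (f (ι p)) :=
    Real.continuous_exp.comp (hf.continuous.comp hS.smooth.continuous)
  refine (h1.div h2 fun p => (Real.exp_pos _).ne').congr fun p => ?_
  rw [Pi.div_apply, (hF.hasDerivAt_weightedRatio hS hu hv hf p).deriv, one_mul,
    mul_div_cancel_left₀ _ (Real.exp_pos _).ne']
  rfl

end WeightedHypersurface

/-! ### The area measure: change of density, local finiteness, positivity on open sets. -/

namespace WeightedHypersurface

open Filter Topology

/-- Only a.e. measurability of `g` is assumed because an inverse chart is controlled only on its
target. -/
theorem withDensity_map {α β : Type*} [MeasurableSpace α] [MeasurableSpace β] {ν : Measure α}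
    {g : α → β} (hg : AEMeasurable g ν) {h : β → ENNReal} (hh : Measurable h) :
    (ν.map g).withDensity h = (ν.withDensity fun a => h (g a)).map g := by
  ext s hs
  have hgd : AEMeasurable g (ν.withDensity fun a => h (g a)) :=
    hg.mono_ac (withDensity_absolutelyContinuous _ _)
  rw [withDensity_apply _ hs, Measure.restrict_map_of_aemeasurable hg hs,
    lintegral_map' hh.aemeasurable hg.restrict, Measure.map_apply_of_aemeasurable hgd hs,
    withDensity_apply₀ _ (hg.nullMeasurableSet_preimage hs)]

variable {n : ℕ}

theorem measurable_ofReal_exp_comp {X : Type*} [TopologicalSpace X] [MeasurableSpace X]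
    [OpensMeasurableSpace X] {Φ : X → EuclideanSpace ℝ (Fin (n + 1))}
    (hΦ : Continuous Φ)
    {f : EuclideanSpace ℝ (Fin (n + 1)) → ℝ} (hf : Continuous f) :
    Measurable fun p => ENNReal.ofReal (Real.exp (f (Φ p))) :=
  (Real.continuous_exp.comp (hf.comp hΦ)).measurable.ennreal_ofReal

variable {H : Type*} [TopologicalSpace H]
  (I : ModelWithCorners ℝ (EuclideanSpace ℝ (Fin n)) H)
  {M : Type*} [TopologicalSpace M] [ChartedSpace H M]

theorem measurableSet_extChartAt_target (c : M) : MeasurableSet (extChartAt I c).target := by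
  rw [extChartAt_target]
  exact ((chartAt H c).open_target.preimage I.continuous_symm).measurableSet.inter
    I.isClosed_range.measurableSet

theorem aemeasurable_extChartAt_symm [MeasurableSpace M] [BorelSpace M] (c : M) :
    AEMeasurable (extChartAt I c).symm
      ((volume : Measure (EuclideanSpace ℝ (Fin n))).restrict (extChartAt I c).target) :=
  (continuousOn_extChartAt_symm c).aemeasurable (measurableSet_extChartAt_target I c)

variable [IsManifold I ∞ M]

theorem continuousOn_areaDensity {Φ : M → EuclideanSpace ℝ (Fin (n + 1))}
    (hΦ : ContMDiff I 𝓘(ℝ, EuclideanSpace ℝ (Fin (n + 1))) ∞ Φ) (c : M) :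
    ContinuousOn (areaDensity I Φ c) (extChartAt I c).target := fun z hz => by
  have h1 : ContDiffWithinAt ℝ ∞ (Φ ∘ (extChartAt I c).symm) (range I) z :=
    contMDiffWithinAt_iff_contDiffWithinAt.1 (hΦ.contMDiffAt.comp_contMDiffWithinAt z
      (contMDiffWithinAt_extChartAt_symm_range c hz))
  have h2 := (h1.fderivWithin_right (m := 0) I.uniqueDiffOn (by norm_cast)
    (extChartAt_target_subset_range c hz)).continuousWithinAt
  exact (Real.continuous_sqrt.comp (contDiff_gramDet (k := 0)).continuous).continuousAt
    |>.comp_continuousWithinAt (h2.mono (extChartAt_target_subset_range c))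

theorem continuous_areaRatio {ι Φ : M → EuclideanSpace ℝ (Fin (n + 1))}
    (hι : ContMDiff I 𝓘(ℝ, EuclideanSpace ℝ (Fin (n + 1))) ∞ ι)
    (hinj : ∀ p, Function.Injective (differential I ι p))
    (hΦ : ContMDiff I 𝓘(ℝ, EuclideanSpace ℝ (Fin (n + 1))) ∞ Φ) :
    Continuous (areaRatio I ι Φ) := by
  refine continuous_iff_continuousAt.2 fun c => ?_
  have h1 : ContinuousOn (fun p => areaDensity I Φ c (extChartAt I c p) /
      areaDensity I ι c (extChartAt I c p)) (extChartAt I c).source :=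
    ((continuousOn_areaDensity I hΦ c).comp (continuousOn_extChartAt c)
      (extChartAt I c).mapsTo).div ((continuousOn_areaDensity I hι c).comp
      (continuousOn_extChartAt c) (extChartAt I c).mapsTo) fun p hp =>
      (areaDensity_pos I hι hinj ((extChartAt I c).map_source hp)).ne'
  refine (h1.congr fun p hp => ?_).continuousAt (extChartAt_source_mem_nhds c)
  rw [← areaRatio_eq_div I hι hinj (hΦ.mdifferentiable (by simp)) ((extChartAt I c).map_source hp),
    (extChartAt I c).left_inv hp]

theorem continuous_weightedRatio {ι Φ : M → EuclideanSpace ℝ (Fin (n + 1))}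
    (hι : ContMDiff I 𝓘(ℝ, EuclideanSpace ℝ (Fin (n + 1))) ∞ ι)
    (hinj : ∀ p, Function.Injective (differential I ι p))
    (hΦ : ContMDiff I 𝓘(ℝ, EuclideanSpace ℝ (Fin (n + 1))) ∞ Φ)
    {f : EuclideanSpace ℝ (Fin (n + 1)) → ℝ} (hf : Continuous f) :
    Continuous (weightedRatio I f ι Φ) :=
  (Real.continuous_exp.comp (hf.comp hΦ.continuous)).mul (continuous_areaRatio I hι hinj hΦ)

variable [T2Space M] [SigmaCompactSpace M]

theorem continuous_chartPartition (c : M) : Continuous (chartPartition I M c) :=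
  (chartPartition I M c).contMDiff.continuous

theorem chartPartition_isSubordinate :
    (chartPartition I M).IsSubordinate fun c => (chartAt H c).source :=
  Classical.choose_spec (SmoothPartitionOfUnity.exists_isSubordinate_chartAt_source I M)

theorem tsupport_chartPartition_subset (c : M) :
    tsupport (chartPartition I M c) ⊆ (extChartAt I c).source := by
  rw [extChartAt_source]
  exact chartPartition_isSubordinate I c

theorem continuousOn_chartPartition_mul_areaDensity {Φ : M → EuclideanSpace ℝ (Fin (n + 1))}
    (hΦ : ContMDiff I 𝓘(ℝ, EuclideanSpace ℝ (Fin (n + 1))) ∞ Φ) (c : M) :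
    ContinuousOn (fun z => chartPartition I M c ((extChartAt I c).symm z) * areaDensity I Φ c z)
      (extChartAt I c).target :=
  ((continuous_chartPartition I c).comp_continuousOn (continuousOn_extChartAt_symm c)).mul
    (continuousOn_areaDensity I hΦ c)

theorem aemeasurable_chartPartition_mul_areaDensity {Φ : M → EuclideanSpace ℝ (Fin (n + 1))}
    (hΦ : ContMDiff I 𝓘(ℝ, EuclideanSpace ℝ (Fin (n + 1))) ∞ Φ) (c : M) :
    AEMeasurable (fun z => ENNReal.ofReal
      (chartPartition I M c ((extChartAt I c).symm z) * areaDensity I Φ c z))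
      (volume.restrict (extChartAt I c).target) :=
  ((continuousOn_chartPartition_mul_areaDensity I hΦ c).aemeasurable
    (measurableSet_extChartAt_target I c)).ennreal_ofReal

variable [MeasurableSpace M] [BorelSpace M]

/-- This moves the dependence on `Φ` from the measure into the integrand, so that a family of areas
can be differentiated under one integral. -/
theorem areaMeasure_eq_withDensity {ι Φ : M → EuclideanSpace ℝ (Fin (n + 1))}
    (hι : ContMDiff I 𝓘(ℝ, EuclideanSpace ℝ (Fin (n + 1))) ∞ ι)
    (hinj : ∀ p, Function.Injective (differential I ι p))
    (hΦ : ContMDiff I 𝓘(ℝ, EuclideanSpace ℝ (Fin (n + 1))) ∞ Φ) :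
    areaMeasure I Φ = (areaMeasure I ι).withDensity fun p => ENNReal.ofReal (areaRatio I ι Φ p) := by
  have hJ : Measurable fun p => ENNReal.ofReal (areaRatio I ι Φ p) :=
    (continuous_areaRatio I hι hinj hΦ).measurable.ennreal_ofReal
  have hJc : ∀ c : M, AEMeasurable (fun z => ENNReal.ofReal (areaRatio I ι Φ
      ((extChartAt I c).symm z))) (volume.restrict (extChartAt I c).target) := fun c =>
    hJ.comp_aemeasurable (aemeasurable_extChartAt_symm I c)
  unfold areaMeasure
  rw [withDensity_sum]
  congr 1
  funext c
  have hg := aemeasurable_extChartAt_symm I c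
  rw [withDensity_map (hg.mono_ac (withDensity_absolutelyContinuous _ _)) hJ,
    ← withDensity_mul₀ (aemeasurable_chartPartition_mul_areaDensity I hι c)
      (hJc c)]
  congr 1
  refine withDensity_congr_ae ?_
  filter_upwards [ae_restrict_mem (measurableSet_extChartAt_target I c)] with z hz
  rw [Pi.mul_apply, ← ENNReal.ofReal_mul (mul_nonneg ((chartPartition I M).nonneg c _)
    (areaDensity_pos I hι hinj hz).le),
    ← areaRatio_mul_areaDensity I hι hinj (hΦ.mdifferentiable (by simp)) hz]
  congr 1
  ring

/-- Only finitely many partition functions meet `K`, and each contributes at most the integral of a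
continuous density over the compact chart image of `K ∩ tsupport`. -/
theorem isFiniteMeasureOnCompacts_areaMeasure {ι : M → EuclideanSpace ℝ (Fin (n + 1))}
    (hι : ContMDiff I 𝓘(ℝ, EuclideanSpace ℝ (Fin (n + 1))) ∞ ι) :
    IsFiniteMeasureOnCompacts (areaMeasure I ι) := by
  refine ⟨fun K hK => ?_⟩
  have hLc : ∀ c : M, IsCompact (extChartAt I c '' (K ∩ tsupport (chartPartition I M c))) :=
    fun c => (hK.inter_right (isClosed_tsupport _)).image_of_continuousOn
      ((continuousOn_extChartAt c).mono (inter_subset_right.trans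
        (tsupport_chartPartition_subset I c)))
  have hterm : ∀ c : M, (((volume.restrict (extChartAt I c).target).withDensity fun z =>
      ENNReal.ofReal (chartPartition I M c ((extChartAt I c).symm z) * areaDensity I ι c z)).map
      (extChartAt I c).symm) K ≤ ∫⁻ z in extChartAt I c '' (K ∩ tsupport (chartPartition I M c)),
        ENNReal.ofReal (chartPartition I M c ((extChartAt I c).symm z) * areaDensity I ι c z) := by
    intro c
    have hg := aemeasurable_extChartAt_symm I c
    rw [Measure.map_apply_of_aemeasurable (hg.mono_ac (withDensity_absolutelyContinuous _ _))
      hK.measurableSet, withDensity_apply₀ _ (hg.nullMeasurableSet_preimage hK.measurableSet),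
      ← lintegral_indicator₀ (hg.nullMeasurableSet_preimage hK.measurableSet),
      ← lintegral_indicator (hLc c).measurableSet]
    refine (lintegral_mono_ae ?_).trans (setLIntegral_le_lintegral _ _)
    filter_upwards [ae_restrict_mem (measurableSet_extChartAt_target I c)] with z hz
    by_cases hzL : z ∈ extChartAt I c '' (K ∩ tsupport (chartPartition I M c))
    · rw [indicator_of_mem hzL]
      exact indicator_le_self _ _ _
    · refine indicator_apply_le' (fun hzK => ?_) fun _ => bot_le
      have h0 : chartPartition I M c ((extChartAt I c).symm z) = 0 := by
        by_contra hne
        exact hzL ⟨_, ⟨hzK, subset_closure hne⟩, (extChartAt I c).right_inv hz⟩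
      rw [h0, zero_mul, ENNReal.ofReal_zero]
      exact bot_le
  rw [areaMeasure, Measure.sum_apply _ hK.measurableSet]
  have hfin := (chartPartition I M).locallyFinite.finite_nonempty_inter_compact hK
  rw [tsum_eq_sum (s := hfin.toFinset)]
  · refine ENNReal.sum_lt_top.2 fun c _ => (hterm c).trans_lt ?_
    have hLt : extChartAt I c '' (K ∩ tsupport (chartPartition I M c)) ⊆ (extChartAt I c).target :=
      image_subset_iff.2 fun p hp =>
        (extChartAt I c).map_source (tsupport_chartPartition_subset I c hp.2)
    have hint := ((continuousOn_chartPartition_mul_areaDensity I hι c).mono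
      hLt).integrableOn_compact (hLc c) (μ := volume)
    exact hint.lintegral_lt_top
  · intro c hc
    refine le_antisymm ((hterm c).trans_eq ?_) bot_le
    rw [Set.Finite.mem_toFinset, mem_ofPred_eq, not_nonempty_iff_eq_empty] at hc
    refine (setLIntegral_congr_fun (g := 0) (hLc c).measurableSet ?_).trans lintegral_zero
    rintro _ ⟨p, hp, rfl⟩
    have h0 : chartPartition I M c p = 0 := by
      by_contra hne
      exact eq_empty_iff_forall_notMem.1 hc p ⟨hne, hp.1⟩
    beta_reduce
    rw [(extChartAt I c).left_inv (tsupport_chartPartition_subset I c hp.2), h0, zero_mul,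
      ENNReal.ofReal_zero, Pi.zero_apply]

/-- Some partition function is positive near `p`. Even if `p` is a boundary point, the chart image
of a neighbourhood contains a nonempty open subset of `ℝⁿ`, on which the density is positive. -/
theorem isOpenPosMeasure_areaMeasure {ι : M → EuclideanSpace ℝ (Fin (n + 1))}
    (hι : ContMDiff I 𝓘(ℝ, EuclideanSpace ℝ (Fin (n + 1))) ∞ ι)
    (hinj : ∀ p, Function.Injective (differential I ι p)) :
    (areaMeasure I ι).IsOpenPosMeasure := by
  refine ⟨fun V hV ⟨p, hp⟩ h0 => ?_⟩
  obtain ⟨c, hc⟩ := (chartPartition I M).exists_pos_of_mem (mem_univ p)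
  have hps : p ∈ (extChartAt I c).source :=
    tsupport_chartPartition_subset I c (subset_closure hc.ne')
  have hg := aemeasurable_extChartAt_symm I c
  rw [areaMeasure, Measure.sum_apply _ hV.measurableSet, ENNReal.tsum_eq_zero] at h0
  have h1 := h0 c
  rw [Measure.map_apply_of_aemeasurable (hg.mono_ac (withDensity_absolutelyContinuous _ _))
    hV.measurableSet, withDensity_apply_eq_zero'
      (aemeasurable_chartPartition_mul_areaDensity I hι c)] at h1
  have hO : (extChartAt I c).target ∩ (extChartAt I c).symm ⁻¹'
      (V ∩ Function.support (chartPartition I M c)) ∈ 𝓝[range I] (extChartAt I c p) := by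
    refine inter_mem (extChartAt_target_mem_nhdsWithin' hps) ?_
    rw [← mem_map, map_extChartAt_symm_nhdsWithin_range' hps]
    exact (hV.inter (continuous_chartPartition I c).isOpen_support).mem_nhds ⟨hp, hc.ne'⟩
  obtain ⟨W, hWo, hpW, hWO⟩ := mem_nhdsWithin.1 hO
  have hW' : IsOpen (W ∩ interior (range I)) := hWo.inter isOpen_interior
  have hne : (W ∩ interior (range I)).Nonempty :=
    mem_closure_iff.1 (I.range_subset_closure_interior (extChartAt_target_subset_range c
      ((extChartAt I c).map_source hps))) W hWo hpW
  have hsub : W ∩ interior (range I) ⊆ (extChartAt I c).target ∩ (extChartAt I c).symm ⁻¹'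
      (V ∩ Function.support (chartPartition I M c)) :=
    fun z hz => hWO ⟨hz.1, interior_subset hz.2⟩
  refine (hW'.measure_pos volume hne).ne' ?_
  rw [← Measure.restrict_eq_self volume (hsub.trans inter_subset_left)]
  refine measure_mono_null (fun z hz => ?_) h1
  obtain ⟨hzt, hzV, hzs⟩ := hsub hz
  refine ⟨?_, hzV⟩
  rw [mem_ofPred_eq, ENNReal.ofReal_ne_zero_iff]
  exact mul_pos (((chartPartition I M).nonneg c _).lt_of_ne' hzs) (areaDensity_pos I hι hinj hzt)

theorem weightedArea_eq_setIntegral {ι Φ : M → EuclideanSpace ℝ (Fin (n + 1))}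
    (hι : ContMDiff I 𝓘(ℝ, EuclideanSpace ℝ (Fin (n + 1))) ∞ ι)
    (hinj : ∀ p, Function.Injective (differential I ι p))
    (hΦ : ContMDiff I 𝓘(ℝ, EuclideanSpace ℝ (Fin (n + 1))) ∞ Φ)
    {f : EuclideanSpace ℝ (Fin (n + 1)) → ℝ} (hf : Continuous f) {K : Set M}
    (hK : MeasurableSet K) :
    weightedArea I f K Φ = ∫ p in K, weightedRatio I f ι Φ p ∂(areaMeasure I ι) := by
  rw [weightedArea, weightedAreaMeasure, areaMeasure_eq_withDensity I hι hinj hΦ,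
    ← withDensity_mul _ (continuous_areaRatio I hι hinj hΦ).measurable.ennreal_ofReal
      (measurable_ofReal_exp_comp hΦ.continuous hf),
    Measure.real, withDensity_apply _ hK, integral_eq_lintegral_of_nonneg_ae
      (Eventually.of_forall fun p => weightedRatio_nonneg I f ι Φ p)
      (continuous_weightedRatio I hι hinj hΦ hf).measurable.aestronglyMeasurable]
  congr 1
  refine lintegral_congr fun p => ?_
  rw [Pi.mul_apply, weightedRatio, mul_comm, ENNReal.ofReal_mul (Real.exp_pos _).le]

theorem integral_weightedAreaMeasure {ι : M → EuclideanSpace ℝ (Fin (n + 1))}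
    (hι : Continuous ι) {f : EuclideanSpace ℝ (Fin (n + 1)) → ℝ} (hf : Continuous f) (u : M → ℝ) :
    ∫ p, u p ∂(weightedAreaMeasure I f ι) =
      ∫ p, Real.exp (f (ι p)) * u p ∂(areaMeasure I ι) := by
  rw [weightedAreaMeasure, integral_withDensity_eq_integral_toReal_smul
    (measurable_ofReal_exp_comp hι hf)
    (Eventually.of_forall fun p => ENNReal.ofReal_lt_top)]
  exact integral_congr_ae (Eventually.of_forall fun p => by
    simp [ENNReal.toReal_ofReal (Real.exp_pos _).le])

end WeightedHypersurface

/-! ### The first variation formula and the characterization of critical hypersurfaces. -/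

namespace WeightedHypersurface

open Filter Topology

variable {n : ℕ} {H : Type*} [TopologicalSpace H]
  {I : ModelWithCorners ℝ (EuclideanSpace ℝ (Fin n)) H}
  {M : Type*} [TopologicalSpace M] [ChartedSpace H M]

/-- The family that defines `firstVariation` is itself admissible, so the general derivative formula
evaluates it. -/
theorem isNormalVariation_add_smul {ι N : M → EuclideanSpace ℝ (Fin (n + 1))}
    (hS : IsTwoSidedHypersurface I ι N) {u : M → ℝ} (hu : IsTestFunction I u) :
    IsNormalVariation I ι N u (tsupport u) fun t p => ι p + (t * u p) • N p where
  compact := hu.compact_support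
  smooth_and_fixed := by
    have h := isSmoothFamily_add_smul hS.smooth hS.normal_smooth hu.smooth
    exact ⟨1, one_pos, h.smooth, fun t _ p hp => by simp [image_eq_zero_of_notMem_tsupport hp]⟩
  initial p := by simp
  velocity p := by
    simpa using ((((hasDerivAt_id (0 : ℝ)).mul_const (u p)).smul_const (N p)).const_add (ι p)).deriv

variable [IsManifold I ∞ M]

/-- In a chart, interior points of `range I` accumulate at every point of `range I`, and interiority
may be tested in any chart of the atlas. -/
theorem dense_interior : Dense (I.interior M) := by
  refine dense_iff_inter_open.2 fun V hV ⟨p, hp⟩ => ?_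
  have hO : (extChartAt I p).target ∩ (extChartAt I p).symm ⁻¹' V ∈
      𝓝[range I] (extChartAt I p p) := by
    refine inter_mem (extChartAt_target_mem_nhdsWithin p) ?_
    rw [← mem_map, map_extChartAt_symm_nhdsWithin_range]
    exact hV.mem_nhds hp
  obtain ⟨W, hWo, hpW, hWO⟩ := mem_nhdsWithin.1 hO
  obtain ⟨z, hzW, hzi⟩ := mem_closure_iff.1 (I.range_subset_closure_interior
    (extChartAt_target_subset_range p (mem_extChartAt_target p))) W hWo hpW
  have hz := hWO ⟨hzW, interior_subset hzi⟩
  refine ⟨(extChartAt I p).symm z, hz.2, ?_⟩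
  have hs : (extChartAt I p).symm z ∈ (chartAt H p).source := by
    rw [← extChartAt_source I]
    exact (extChartAt I p).map_target hz.1
  refine (I.isInteriorPoint_iff_of_mem_atlas (n := ∞) (by simp) (chart_mem_atlas H p) hs).2 ?_
  change extChartAt I p ((extChartAt I p).symm z) ∈ interior (extChartAt I p).target
  rw [(extChartAt I p).right_inv hz.1]
  refine mem_interior.2 ⟨W ∩ interior (range I), fun y hy => (hWO ⟨hy.1, interior_subset hy.2⟩).1,
    hWo.inter isOpen_interior, hzW, hzi⟩

theorem exists_isTestFunction [T2Space M] {p : M} (hp : p ∈ I.interior M) {V : Set M} (hV : V ∈ 𝓝 p) :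
    ∃ u : M → ℝ, IsTestFunction I u ∧ 0 ≤ u ∧ u p = 1 ∧ tsupport u ⊆ V := by
  have hint : I.interior M ∈ 𝓝 p := (I.isOpen_interior (n := ∞) (by simp)).mem_nhds hp
  obtain ⟨φ, -, hφ⟩ := (SmoothBumpFunction.nhds_basis_tsupport (I := I) p).mem_iff.1
    (inter_mem hint hV)
  exact ⟨φ, ⟨φ.contMDiff, φ.hasCompactSupport, hφ.trans inter_subset_left⟩, fun _ => φ.nonneg,
    φ.eq_one, hφ.trans inter_subset_right⟩

theorem IsSmoothFamily.exists_lipschitz_of_isCompact {ι : M → EuclideanSpace ℝ (Fin (n + 1))}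
    {F : ℝ → M → EuclideanSpace ℝ (Fin (n + 1))} {ε : ℝ} (h : IsSmoothFamily I ι F ε)
    (hι : ContMDiff I 𝓘(ℝ, EuclideanSpace ℝ (Fin (n + 1))) ∞ ι)
    (hinj : ∀ p, Function.Injective (differential I ι p))
    {f : EuclideanSpace ℝ (Fin (n + 1)) → ℝ} (hf : ContDiff ℝ 1 f) {K : Set M}
    (hK : IsCompact K) :
    ∃ C : NNReal, ∃ δ > 0,
      ∀ p ∈ K, LipschitzOnWith C (fun t => weightedRatio I f ι (F t) p) (Ioo (-δ) δ) := by
  refine hK.induction_on (p := fun K => ∃ C : NNReal, ∃ δ > 0, ∀ p ∈ K,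
    LipschitzOnWith C (fun t => weightedRatio I f ι (F t) p) (Ioo (-δ) δ)) ⟨0, 1, one_pos, by simp⟩
    ?_ ?_ fun c _ => ?_
  · rintro s t hst ⟨C, δ, hδ, hC⟩
    exact ⟨C, δ, hδ, fun p hp => hC p (hst hp)⟩
  · rintro s t ⟨C, δ, hδ, hC⟩ ⟨C', δ', hδ', hC'⟩
    refine ⟨max C C', min δ δ', lt_min hδ hδ', fun p hp => ?_⟩
    rcases hp with hp | hp
    · exact ((hC p hp).mono (Ioo_subset_Ioo (neg_le_neg (min_le_left _ _))
        (min_le_left _ _))).weaken (le_max_left _ _)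
    · exact ((hC' p hp).mono (Ioo_subset_Ioo (neg_le_neg (min_le_right _ _))
        (min_le_right _ _))).weaken (le_max_right _ _)
  · obtain ⟨C, δ, hδ, V, hV, hC⟩ := h.exists_lipschitz hι hinj hf c
    exact ⟨V, mem_nhdsWithin_of_mem_nhds hV, C, δ, hδ, hC⟩

variable [T2Space M] [SigmaCompactSpace M] [MeasurableSpace M] [BorelSpace M]

/-- The first variation formula: along a variation with normal speed `u` the weighted area changes
at the rate `∫ u (H + ⟨∇f, N⟩) e^f dA`. -/
theorem IsNormalVariation.hasDerivAt_weightedArea {ι N : M → EuclideanSpace ℝ (Fin (n + 1))}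
    (hS : IsTwoSidedHypersurface I ι N) {f : EuclideanSpace ℝ (Fin (n + 1)) → ℝ}
    (hf : ContDiff ℝ 1 f) {u : M → ℝ} {K : Set M} {F : ℝ → M → EuclideanSpace ℝ (Fin (n + 1))}
    (hu : IsTestFunction I u) (hF : IsNormalVariation I ι N u K F) :
    HasDerivAt (fun t => weightedArea I f K (F t))
      (∫ p, Real.exp (f (ι p)) * (u p * weightedMeanCurvature I f ι N p) ∂(areaMeasure I ι)) 0 := by
  obtain ⟨ε, hε, hsmooth, hfix⟩ := hF.smooth_and_fixed
  have h : IsSmoothFamily I ι F ε := ⟨hε, hsmooth, funext hF.initial⟩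
  have hv : ∀ p, HasDerivAt (fun t => F t p) (u p • N p) 0 := fun p => by
    rw [← hF.velocity p]
    exact (h.differentiableAt p).hasDerivAt
  -- Off `K` nothing moves, so `u N = 0` there while `N ≠ 0`. This lets the integral over `K` be
  -- replaced by one over `M`, independent of `K`.
  have hu0 : ∀ p ∉ K, u p = 0 := fun p hp => by
    have h1 : HasDerivAt (fun t => F t p) 0 0 :=
      (hasDerivAt_const (0 : ℝ) (ι p)).congr_of_eventuallyEq
        (h.eventually_mem.mono fun t ht => hfix t ht p hp)
    have hN : N p ≠ 0 := fun h0 => by simpa [h0] using hS.normal_unit p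
    exact (smul_eq_zero.1 ((hv p).unique h1)).resolve_right hN
  have hKm : MeasurableSet K := hF.compact.measurableSet
  have := isFiniteMeasureOnCompacts_areaMeasure I hS.smooth
  have : IsFiniteMeasure ((areaMeasure I ι).restrict K) :=
    ⟨by rw [Measure.restrict_apply_univ]; exact hF.compact.measure_lt_top⟩
  obtain ⟨C, δ, hδ, hC⟩ := h.exists_lipschitz_of_isCompact hS.smooth hS.immersion hf hF.compact
  have hcont : ∀ t ∈ Ioo (-ε) ε, Continuous (weightedRatio I f ι (F t)) := fun t ht =>
    continuous_weightedRatio I hS.smooth hS.immersion (h.contMDiff ht) hf.continuous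
  have hexp : Continuous fun p => Real.exp (f (ι p)) :=
    Real.continuous_exp.comp (hf.continuous.comp hS.smooth.continuous)
  have hderiv := (hasDerivAt_integral_of_dominated_loc_of_lip
    (μ := (areaMeasure I ι).restrict K) (x₀ := (0 : ℝ)) (s := Ioo (-δ) δ) (bound := fun _ => (C : ℝ))
    (F := fun t p => weightedRatio I f ι (F t) p)
    (F' := fun p => Real.exp (f (ι p)) * (u p * weightedMeanCurvature I f ι N p))
    (Ioo_mem_nhds (by linarith) hδ)
    (h.eventually_mem.mono fun t ht => (hcont t ht).measurable.aestronglyMeasurable)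
    ((hcont 0 h.zero_mem).continuousOn.integrableOn_compact hF.compact)
    (hexp.mul (hu.smooth.continuous.mul
      (continuous_weightedMeanCurvature I hS hf))).measurable.aestronglyMeasurable
    ?_ (integrable_const _)
    (Eventually.of_forall fun p => h.hasDerivAt_weightedRatio hS hu.smooth hv hf p)).2
  · rw [setIntegral_eq_integral_of_forall_compl_eq_zero fun p hp => by simp [hu0 p hp]] at hderiv
    refine hderiv.congr_of_eventuallyEq (h.eventually_mem.mono fun t ht => ?_)
    exact weightedArea_eq_setIntegral I hS.smooth hS.immersion (h.contMDiff ht) hf.continuous hKm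
  · filter_upwards [ae_restrict_mem hKm] with p hp
    simpa using hC p hp

theorem firstVariation_eq {ι N : M → EuclideanSpace ℝ (Fin (n + 1))}
    (hS : IsTwoSidedHypersurface I ι N) {f : EuclideanSpace ℝ (Fin (n + 1)) → ℝ}
    (hf : ContDiff ℝ 1 f) {u : M → ℝ} (hu : IsTestFunction I u) :
    firstVariation I f ι N u =
      ∫ p, Real.exp (f (ι p)) * (u p * weightedMeanCurvature I f ι N p) ∂(areaMeasure I ι) :=
  ((isNormalVariation_add_smul hS hu).hasDerivAt_weightedArea hS hf hu).deriv

/-- If the inequality failed, moving weighted mass between the sets `h < m` and `h > m` would be a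
mean-zero variation with nonzero first variation. -/
theorem weightedMeanCurvature_le_of_isCriticalForMeanZero
    {ι N : M → EuclideanSpace ℝ (Fin (n + 1))} (hS : IsTwoSidedHypersurface I ι N)
    {f : EuclideanSpace ℝ (Fin (n + 1)) → ℝ} (hf : ContDiff ℝ 1 f)
    (hcrit : IsCriticalForMeanZero I f ι N) {p q : M} (hp : p ∈ I.interior M)
    (hq : q ∈ I.interior M) :
    weightedMeanCurvature I f ι N q ≤ weightedMeanCurvature I f ι N p := by
  by_contra! hlt
  have := isFiniteMeasureOnCompacts_areaMeasure I hS.smooth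
  have := isOpenPosMeasure_areaMeasure I hS.smooth hS.immersion
  have hh := continuous_weightedMeanCurvature I hS hf
  set h := weightedMeanCurvature I f ι N with hdef
  have hW : Continuous fun p => Real.exp (f (ι p)) :=
    Real.continuous_exp.comp (hf.continuous.comp hS.smooth.continuous)
  obtain ⟨m, hpm, hmq⟩ := exists_between hlt
  obtain ⟨a, ha, ha0, hap, haV⟩ :=
    exists_isTestFunction hp ((isOpen_Iio.preimage hh).mem_nhds (show h p < m from hpm))
  obtain ⟨b, hb, hb0, hbq, hbV⟩ :=
    exists_isTestFunction hq ((isOpen_Ioi.preimage hh).mem_nhds (show m < h q from hmq))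
  have hai : Integrable (fun x => Real.exp (f (ι x)) * a x) (areaMeasure I ι) :=
    (hW.mul ha.smooth.continuous).integrable_of_hasCompactSupport ha.compact_support.mul_left
  have hbi : Integrable (fun x => Real.exp (f (ι x)) * b x) (areaMeasure I ι) :=
    (hW.mul hb.smooth.continuous).integrable_of_hasCompactSupport hb.compact_support.mul_left
  set α := ∫ x, Real.exp (f (ι x)) * a x ∂(areaMeasure I ι) with hα
  set β := ∫ x, Real.exp (f (ι x)) * b x ∂(areaMeasure I ι) with hβ
  have hαpos : 0 ≤ α := integral_nonneg fun x => mul_nonneg (Real.exp_pos _).le (ha0 x)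
  have hβpos : 0 < β := (hW.mul hb.smooth.continuous).integral_pos_of_hasCompactSupport_nonneg_nonzero
    hb.compact_support.mul_left (fun x => mul_nonneg (Real.exp_pos _).le (hb0 x)) (x := q)
    (by simp [hbq])
  -- The coefficients are the weighted integrals of the opposite bumps, which makes the weighted
  -- mean zero. Strict positivity is needed only for `β`.
  set u : M → ℝ := fun x => β * a x - α * b x with hu
  have hut : IsTestFunction I u := by
    have hsub : tsupport u ⊆ tsupport a ∪ tsupport b := by
      refine closure_minimal (fun x hx => ?_) ((isClosed_tsupport _).union (isClosed_tsupport _))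
      by_contra hx'
      rw [mem_union, not_or] at hx'
      exact hx (by simp [hu, image_eq_zero_of_notMem_tsupport hx'.1,
        image_eq_zero_of_notMem_tsupport hx'.2])
    exact ⟨(contMDiff_const.mul ha.smooth).sub (contMDiff_const.mul hb.smooth),
      (ha.compact_support.isCompact.union hb.compact_support.isCompact).of_isClosed_subset
        (isClosed_tsupport _) hsub,
      hsub.trans (union_subset ha.support_interior hb.support_interior)⟩
  have humean : ∫ x, Real.exp (f (ι x)) * u x ∂(areaMeasure I ι) = 0 := by
    have : (fun x => Real.exp (f (ι x)) * u x) = fun x =>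
        β * (Real.exp (f (ι x)) * a x) - α * (Real.exp (f (ι x)) * b x) := by
      funext x
      simp only [hu]
      ring
    rw [this, integral_sub (hai.const_mul _) (hbi.const_mul _), integral_const_mul,
      integral_const_mul, ← hα, ← hβ]
    ring
  have hvar := hcrit u hut
    ((integral_weightedAreaMeasure I hS.smooth.continuous hf.continuous u).trans humean)
  rw [firstVariation_eq hS hf hut] at hvar
  have hui : Integrable (fun x => Real.exp (f (ι x)) * u x) (areaMeasure I ι) :=
    (hW.mul hut.smooth.continuous).integrable_of_hasCompactSupport hut.compact_support.mul_left
  have huhi : Integrable (fun x => Real.exp (f (ι x)) * (u x * h x)) (areaMeasure I ι) :=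
    (hW.mul (hut.smooth.continuous.mul hh)).integrable_of_hasCompactSupport
      hut.compact_support.mul_right.mul_left
  -- Since `u` has mean zero, the constant `m` can be inserted for free.
  have hzero : ∫ x, Real.exp (f (ι x)) * (u x * (m - h x)) ∂(areaMeasure I ι) = 0 := by
    have : (fun x => Real.exp (f (ι x)) * (u x * (m - h x))) = fun x =>
        m * (Real.exp (f (ι x)) * u x) - Real.exp (f (ι x)) * (u x * h x) := by
      funext x
      ring
    rw [this, integral_sub (hui.const_mul _) huhi, integral_const_mul, humean, hvar]
    simp
  have ha_lt : ∀ x, a x ≠ 0 → h x < m := fun x hx => haV (subset_closure hx)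
  have hb_lt : ∀ x, b x ≠ 0 → m < h x := fun x hx => hbV (subset_closure hx)
  refine (Continuous.integral_pos_of_hasCompactSupport_nonneg_nonzero (μ := areaMeasure I ι)
    (hW.mul (hut.smooth.continuous.mul (continuous_const.sub hh)))
    hut.compact_support.mul_right.mul_left (fun x => ?_) (x := p) ?_).ne' hzero
  · refine mul_nonneg (Real.exp_pos _).le ?_
    have h1 : 0 ≤ a x * (m - h x) := by
      by_cases hx : a x = 0
      · simp [hx]
      · exact mul_nonneg (ha0 x) (sub_pos.2 (ha_lt x hx)).le
    have h2 : 0 ≤ b x * (h x - m) := by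
      by_cases hx : b x = 0
      · simp [hx]
      · exact mul_nonneg (hb0 x) (sub_pos.2 (hb_lt x hx)).le
    have h3 : u x * (m - h x) = β * (a x * (m - h x)) + α * (b x * (h x - m)) := by
      simp only [hu]
      ring
    change 0 ≤ u x * (m - h x)
    rw [h3]
    positivity
  -- The support of `b` lies in `m < h`, which excludes `p`; hence the integrand at `p` is a
  -- positive multiple of `β (m - h p)`.
  · have hbp : b p = 0 := by
      by_contra hne
      exact (hb_lt p hne).not_gt hpm
    have hup : u p = β := by simp [hu, hap, hbp]
    change Real.exp (f (ι p)) * (u p * (m - h p)) ≠ 0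
    rw [hup]
    exact mul_ne_zero (Real.exp_pos _).ne' (mul_ne_zero hβpos.ne' (sub_pos.2 hpm).ne')

theorem isCriticalForMeanZero_iff {ι N : M → EuclideanSpace ℝ (Fin (n + 1))}
    (hS : IsTwoSidedHypersurface I ι N) {f : EuclideanSpace ℝ (Fin (n + 1)) → ℝ}
    (hf : ContDiff ℝ 1 f) :
    IsCriticalForMeanZero I f ι N ↔
      ∃ C : ℝ, ∀ p : M, meanCurvature I ι N p + inner ℝ (∇ f (ι p)) (N p) = C := by
  constructor
  · intro hcrit
    rcases isEmpty_or_nonempty M with hM | hM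
    · exact ⟨0, fun p => isEmptyElim p⟩
    obtain ⟨q, hq⟩ := (dense_interior (I := I) (M := M)).nonempty
    refine ⟨weightedMeanCurvature I f ι N q, fun p => ?_⟩
    -- Test functions only see interior points, so equality is obtained there by using the
    -- inequality in both directions, then extended by density.
    have hEq : EqOn (weightedMeanCurvature I f ι N) (fun _ => weightedMeanCurvature I f ι N q)
        (I.interior M) := fun p hp =>
      le_antisymm (weightedMeanCurvature_le_of_isCriticalForMeanZero hS hf hcrit hq hp)
        (weightedMeanCurvature_le_of_isCriticalForMeanZero hS hf hcrit hp hq)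
    exact congrFun (Continuous.ext_on dense_interior (continuous_weightedMeanCurvature I hS hf)
      continuous_const hEq) p
  · rintro ⟨C, hC⟩ u hu hmean
    rw [integral_weightedAreaMeasure I hS.smooth.continuous hf.continuous] at hmean
    rw [firstVariation_eq hS hf hu]
    have : (fun p => Real.exp (f (ι p)) * (u p * weightedMeanCurvature I f ι N p)) =
        fun p => C * (Real.exp (f (ι p)) * u p) := by
      funext p
      rw [weightedMeanCurvature, hC p]
      ring
    rw [this, integral_const_mul, hmean, mul_zero]

theorem gradient_neg_norm_sq_div_four {E : Type*} [NormedAddCommGroup E] [InnerProductSpace ℝ E]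
    [CompleteSpace E] (x : E) : ∇ (fun x : E => -‖x‖ ^ 2 / 4) x = (-(1 / 2) : ℝ) • x := by
  refine HasGradientAt.gradient (hasGradientAt_iff_hasFDerivAt.2 ?_)
  have h := ((hasStrictFDerivAt_norm_sq x).hasFDerivAt.neg).mul_const (1 / 4 : ℝ)
  refine (h.congr_fderiv ?_).congr_of_eventuallyEq (Eventually.of_forall fun y => ?_)
  · ext v
    simp
    ring
  · simp
    ring

end WeightedHypersurface

/-- The first variation of the weighted area `∫ e^f dA` of a two-sided immersed hypersurface is
well defined (it is the derivative of the weighted area along every compactly supported variation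
with the given normal speed), and it vanishes on all test functions of weighted mean zero if and
only if `H + ⟨∇f, N⟩` is constant; for `f = -|x|²/4` this is `H = ⟨x, N⟩ / 2 + C`. -/
theorem lemma1p2 {n : ℕ} {H : Type*} [TopologicalSpace H]
    (I : ModelWithCorners ℝ (EuclideanSpace ℝ (Fin n)) H)
    {M : Type*} [TopologicalSpace M] [ChartedSpace H M] [IsManifold I ∞ M]
    [T2Space M] [SigmaCompactSpace M] [MeasurableSpace M] [BorelSpace M]
    (ι N : M → EuclideanSpace ℝ (Fin (n + 1)))
    (hS : WeightedHypersurface.IsTwoSidedHypersurface I ι N) :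
    (∀ f : EuclideanSpace ℝ (Fin (n + 1)) → ℝ, ContDiff ℝ 1 f →
      (∀ (u : M → ℝ) (K : Set M) (F : ℝ → M → EuclideanSpace ℝ (Fin (n + 1))),
        WeightedHypersurface.IsTestFunction I u →
        WeightedHypersurface.IsNormalVariation I ι N u K F →
        HasDerivAt (fun t => WeightedHypersurface.weightedArea I f K (F t))
          (WeightedHypersurface.firstVariation I f ι N u) 0) ∧
      (WeightedHypersurface.IsCriticalForMeanZero I f ι N ↔
        ∃ C : ℝ, ∀ p : M,
          WeightedHypersurface.meanCurvature I ι N p + inner ℝ (∇ f (ι p)) (N p) = C)) ∧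
    (WeightedHypersurface.IsCriticalForMeanZero I (fun x => -‖x‖ ^ 2 / 4) ι N ↔
      ∃ C : ℝ, ∀ p : M,
        WeightedHypersurface.meanCurvature I ι N p = inner ℝ (ι p) (N p) / 2 + C) := by
  refine ⟨fun f hf => ⟨fun u K F hu hF => ?_,
    WeightedHypersurface.isCriticalForMeanZero_iff hS hf⟩, ?_⟩
  · rw [WeightedHypersurface.firstVariation_eq hS hf hu]
    exact hF.hasDerivAt_weightedArea hS hf hu
  · have hf : ContDiff ℝ 1 fun x : EuclideanSpace ℝ (Fin (n + 1)) => -‖x‖ ^ 2 / 4 :=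
      ((contDiff_norm_sq ℝ).neg).div_const 4
    rw [WeightedHypersurface.isCriticalForMeanZero_iff hS hf]
    refine exists_congr fun C => forall_congr' fun p => ?_
    rw [WeightedHypersurface.gradient_neg_norm_sq_div_four, real_inner_smul_left]
    constructor <;> intro h <;> linarith
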